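/- We work over the complex field $\mathbb C$. Let $X\subset\mathbb P^r$ be an integral (reduced and irreducible) closed subvariety of dimension $n$ that is non-degenerate, i.e. contained in no hyperplane. A $k$-plane in $\mathbb P^r$ is called $(k+1)$-secant to $X$ if it is spanned by $k+1$ points of $X$. Let $G(k,r)$ be the Grassmannian of $k$-planes in $\mathbb P^r$. Let $S_1(X)\subset\mathbb P^r$ be the secant variety of $X$, the closure of the union of all $2$-secant lines of $X$. Let $G_2(X)\subset G(2,r)$ be the closure of the set of $3$-secant planes of $X$, and let $G_{1,2}(X)\subset G(1,r)$ be the closure of the set of lines contained in some plane belonging to $G_2(X)$. **Theorem 1.9.** If $\dim G_{1,2}(X)<3n+2$ and $\dim S_1(X)=2n<r$, then $X$ is a cone, i.e. there is a point $v\in X$ such that for every $x\in X$ with $x\ne v$ the line joining $v$ and $x$ is contained in $X$. -/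

import Mathlib

open scoped LinearAlgebra.Projectivization

/-- The projective space `ℙ^r` over `ℂ`, as the set of its closed points. -/
abbrev ProjSp (r : ℕ) : Type := ℙ ℂ (Fin (r + 1) → ℂ)

/-- The zero locus in projective space of a set of polynomials (used for homogeneous polynomials,
whose vanishing at a point does not depend on the chosen representative). -/
def projZeroLocus {σ : Type} (S : Set (MvPolynomial σ ℂ)) : Set (ℙ ℂ (σ → ℂ)) :=
  {x | ∀ p ∈ S, MvPolynomial.eval x.rep p = 0}

/-- Projective algebraic sets: zero loci of sets of homogeneous polynomials. -/
def projAlgebraicSets (σ : Type) : Set (Set (ℙ ℂ (σ → ℂ))) :=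
  {Z | ∃ S : Set (MvPolynomial σ ℂ), (∀ p ∈ S, ∃ d : ℕ, p.IsHomogeneous d) ∧ Z = projZeroLocus S}

/-- The Zariski topology on the projective space with homogeneous coordinates indexed by `σ`:
its closed sets are the projective algebraic sets. -/
instance zariskiTopology (σ : Type) : TopologicalSpace (ℙ ℂ (σ → ℂ)) :=
  TopologicalSpace.ofClosed (projAlgebraicSets σ)
    ⟨{1}, by
      rintro p rfl
      exact ⟨0, MvPolynomial.isHomogeneous_one σ ℂ⟩, by
      ext x
      simp [projZeroLocus]⟩
    (by
      intro A hA
      refine ⟨{p | (∃ d : ℕ, p.IsHomogeneous d) ∧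
        ∃ Z ∈ A, ∀ x ∈ Z, MvPolynomial.eval x.rep p = 0}, fun p hp => hp.1, ?_⟩
      ext x
      constructor
      · rintro hx p ⟨-, Z, hZ, hp⟩
        exact hp x (hx Z hZ)
      · intro hx Z hZ
        obtain ⟨S, hS, rfl⟩ := hA hZ
        intro p hp
        exact hx p ⟨hS p hp, _, hZ, fun y hy => hy p hp⟩)
    (by
      rintro _ ⟨S, hS, rfl⟩ _ ⟨T, hT, rfl⟩
      refine ⟨{f | ∃ p ∈ S, ∃ q ∈ T, f = p * q}, ?_, ?_⟩
      · rintro _ ⟨p, hp, q, hq, rfl⟩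
        obtain ⟨d, hd⟩ := hS p hp
        obtain ⟨e, he⟩ := hT q hq
        exact ⟨d + e, hd.mul he⟩
      · ext x
        constructor
        · rintro (hx | hx) _ ⟨p, hp, q, hq, rfl⟩
          · rw [map_mul, hx p hp, zero_mul]
          · rw [map_mul, hx q hq, mul_zero]
        · intro hx
          by_contra hcon
          rw [Set.mem_union, not_or] at hcon
          simp only [projZeroLocus, Set.mem_ofPred_eq, not_forall] at hcon
          obtain ⟨⟨p, hp, hp0⟩, q, hq, hq0⟩ := hcon
          have h := hx (p * q) ⟨p, hp, q, hq, rfl⟩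
          rw [map_mul] at h
          exact (mul_ne_zero hp0 hq0) h)

/-- The Grassmannian `G(k, r)` of `k`-planes in `ℙ^r`, i.e. of linear subspaces of dimension
`k + 1` of `ℂ^(r+1)`. -/
structure Grass (k r : ℕ) : Type where
  /-- the linear subspace of `ℂ^(r+1)` underlying the `k`-plane -/
  space : Submodule ℂ (Fin (r + 1) → ℂ)
  finrank_space : Module.finrank ℂ space = k + 1

namespace Grass

variable {k r : ℕ}

/-- A matrix whose rows form a basis of the linear subspace underlying a `k`-plane. -/
noncomputable def basisMatrix (L : Grass k r) : Matrix (Fin (k + 1)) (Fin (r + 1)) ℂ :=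
  fun i j => (Module.finBasisOfFinrankEq ℂ L.space L.finrank_space i : Fin (r + 1) → ℂ) j

/-- The Plücker coordinates of a `k`-plane: the maximal minors of a basis matrix. -/
noncomputable def pluckerVec (L : Grass k r) : (Fin (k + 1) ↪o Fin (r + 1)) → ℂ :=
  fun s => (L.basisMatrix.submatrix id s).det

theorem pluckerVec_ne_zero (L : Grass k r) : L.pluckerVec ≠ 0 := by
  have hrow : LinearIndependent ℂ L.basisMatrix.row :=
    (Module.finBasisOfFinrankEq ℂ L.space L.finrank_space).linearIndependent.map'
      L.space.subtype (Submodule.ker_subtype _)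
  have hrank : L.basisMatrix.rank = k + 1 := by
    simpa using hrow.rank_matrix
  rw [Matrix.rank_eq_finrank_span_cols] at hrank
  have htop : Submodule.span ℂ (Set.range L.basisMatrix.col) = ⊤ :=
    Submodule.eq_top_of_finrank_eq (by rw [hrank]; simp)
  obtain ⟨κ, a, ha, hspan, hli⟩ := exists_linearIndependent' ℂ L.basisMatrix.col
  have : Fintype κ := Fintype.ofInjective a ha
  have hcard : Fintype.card κ = k + 1 := by
    have h := finrank_span_eq_card hli
    rw [hspan, hrank] at h
    exact h.symm
  classical
  let s : Finset (Fin (r + 1)) := Finset.univ.image a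
  have hs : s.card = k + 1 := by
    rw [Finset.card_image_of_injective _ ha, Finset.card_univ, hcard]
  have hmem : ∀ i, ∃ c, a c = s.orderEmbOfFin hs i := fun i => by
    have h := s.orderEmbOfFin_mem hs i
    obtain ⟨c, -, hc⟩ := Finset.mem_image.mp h
    exact ⟨c, hc⟩
  choose c hc using hmem
  have hcinj : Function.Injective c := fun i j hij =>
    (s.orderEmbOfFin hs).injective (by rw [← hc i, ← hc j, hij])
  have hcol : LinearIndependent ℂ (L.basisMatrix.submatrix id (s.orderEmbOfFin hs)).col := by
    have heq : (L.basisMatrix.submatrix id (s.orderEmbOfFin hs)).col =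
        (L.basisMatrix.col ∘ a) ∘ c := by
      funext i j
      change L.basisMatrix j (s.orderEmbOfFin hs i) = L.basisMatrix j (a (c i))
      rw [hc]
    rw [heq]
    exact hli.comp c hcinj
  intro h0
  have hu := Matrix.linearIndependent_cols_iff_isUnit.mp hcol
  rw [Matrix.isUnit_iff_isUnit_det] at hu
  exact hu.ne_zero (congrFun h0 (s.orderEmbOfFin hs))

/-- The Plücker embedding of the Grassmannian. -/
noncomputable def plucker (L : Grass k r) : ℙ ℂ ((Fin (k + 1) ↪o Fin (r + 1)) → ℂ) :=
  Projectivization.mk ℂ L.pluckerVec L.pluckerVec_ne_zero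

/-- The Zariski topology on the Grassmannian, as a subspace of the Plücker space. -/
noncomputable instance zariskiTopologyGrass : TopologicalSpace (Grass k r) :=
  TopologicalSpace.induced plucker (zariskiTopology _)

end Grass

/-- The `(k+1)`-secant `k`-planes of `X`, i.e. the image of the span map: the `k`-planes spanned
by `k + 1` (necessarily independent) points of `X`. -/
def secantPlanes {r : ℕ} (k : ℕ) (X : Set (ProjSp r)) : Set (Grass k r) :=
  {H | ∃ x : Fin (k + 1) → ProjSp r, (∀ i, x i ∈ X) ∧ H.space = ⨆ i, (x i).submodule}

/-- `G_k(X)`: the closure in `G(k, r)` of the set of `(k+1)`-secant `k`-planes of `X`. -/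
def secantGrass {r : ℕ} (k : ℕ) (X : Set (ProjSp r)) : Set (Grass k r) :=
  closure (secantPlanes k X)

/-- `G_{h,k}(X)`: the closure in `G(h, r)` of the set of `h`-planes contained in some member of
`G_k(X)`. -/
def secantSubGrass {r : ℕ} (h k : ℕ) (X : Set (ProjSp r)) : Set (Grass h r) :=
  closure {L | ∃ H ∈ secantGrass k X, L.space ≤ H.space}

/-- `S_k(X)`: the `k`-th secant variety, the closure in `ℙ^r` of the union of all `(k+1)`-secant
`k`-planes of `X`. -/
def secantVariety {r : ℕ} (k : ℕ) (X : Set (ProjSp r)) : Set (ProjSp r) :=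
  closure {y | ∃ H ∈ secantPlanes k X, y.submodule ≤ H.space}

/-- `X` is non-degenerate: it lies in no proper linear subspace of `ℙ^r`. -/
def IsNondegenerate {r : ℕ} (X : Set (ProjSp r)) : Prop :=
  ∀ W : Submodule ℂ (Fin (r + 1) → ℂ), (∀ x ∈ X, x.submodule ≤ W) → W = ⊤

/-- `X` is a cone: there is a point `v` of `X` (a vertex) such that `X` contains, with every point
`x`, the whole line joining `v` and `x`. -/
def IsProjCone {r : ℕ} (X : Set (ProjSp r)) : Prop :=
  ∃ v ∈ X, ∀ x ∈ X, ∀ y : ProjSp r, y.submodule ≤ v.submodule ⊔ x.submodule → y ∈ X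

/-!
The proof is Terracini's infinitesimal argument, carried out with generic points. Let `C` be the
affine cone over `X`, of dimension `n + 1`. A triple `x 0`, `x 1`, `x 2` of points of `C` over a
large field `K`, generic in the sense that only those polynomial relations hold between its
coordinates that hold on all of `C × C × C`, carries tangent spaces `T 0`, `T 1`, `T 2`, and
derivations of `K` over `ℂ` move the three points independently in arbitrary tangent directions
(`IsGeneric.exists_derivation`). The dimension of a projective variety is read off from the
transcendence degree of its homogeneous coordinate ring (`exists_topologicalKrullDim_eq_trdeg`),
hence from the dimension of the tangent space at a generic point of its cone
(`finrank_tangentSpace`).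

* The point `x i + x j` is generic on the cone over the secant variety, with tangent space
  `T i + T j`. As the secant variety has dimension `2 n`, the spaces `T i` and `T j` meet in a line,
  and as it is not the whole space while `X` is nondegenerate, the third point does not lie in
  `T i + T j` (`IsGeneric.notMem_sup`).
* The line joining `x 0 + x 2` and `x 1 + x 2` is a general line in a general trisecant plane, and
  its Plücker vector `(x 0 + x 2) ∧ (x 1 + x 2)` is a generic point of a cone of dimension at most
  `3 n + 2` (`IsGeneric.finrank_tangentSpace_wedge_le`). Hence the differential of this map, defined
  on `T 0 × T 1 × T 2`, has a kernel, and linear algebra makes of a kernel element a nonzero vector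
  common to the three tangent spaces (`IsGeneric.exists_mem_tangentSpace`).
* So the three lines `T i ∩ T j` coincide. A derivation fixing `x i` and `x j` maps `T i ∩ T j` to
  itself, and every derivation is a sum of derivations each fixing two of the three points; so the
  common line is constant, that is, spanned by a vector `v` over `ℂ`
  (`IsGeneric.exists_constant_of_mem_inf`).
* Since `v` is tangent to `C` at a generic point, the derivative in the direction `v` preserves the
  ideal of `X`, and by Taylor's formula `C` is stable under translation by multiples of `v`: the
  point `v` is a vertex of `X` (`isProjCone_of_derivative_mem`).
-/

open MvPolynomial

attribute [local instance] MvPolynomial.gradedAlgebra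

/-! ### Affine cones and homogeneous ideals -/

/-- The affine cone over a subset of projective space, the origin always included. -/
def affineCone {σ : Type} (Z : Set (ℙ ℂ (σ → ℂ))) : Set (σ → ℂ) :=
  {v | ∀ h : v ≠ 0, Projectivization.mk ℂ v h ∈ Z}

/-- The ideal of all polynomials vanishing on the affine cone over `Z`. -/
noncomputable abbrev coneIdeal {σ : Type} (Z : Set (ℙ ℂ (σ → ℂ))) : Ideal (MvPolynomial σ ℂ) :=
  vanishingIdeal ℂ (affineCone Z)

section Cone

variable {σ : Type}

theorem zero_mem_affineCone (Z : Set (ℙ ℂ (σ → ℂ))) : (0 : σ → ℂ) ∈ affineCone Z :=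
  fun h => absurd rfl h

theorem smul_mem_affineCone {Z : Set (ℙ ℂ (σ → ℂ))} {v : σ → ℂ} (hv : v ∈ affineCone Z) (c : ℂ) :
    c • v ∈ affineCone Z := by
  intro h
  have hv0 : v ≠ 0 := by rintro rfl; simp at h
  have hc : c ≠ 0 := by rintro rfl; simp at h
  convert hv hv0 using 1
  rw [Projectivization.mk_eq_mk_iff']
  exact ⟨c, rfl⟩

theorem mk_mem_iff {Z : Set (ℙ ℂ (σ → ℂ))} {v : σ → ℂ} (h : v ≠ 0) :
    Projectivization.mk ℂ v h ∈ Z ↔ v ∈ affineCone Z :=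
  ⟨fun hv _ => hv, fun hv => hv h⟩

theorem rep_mem_affineCone {Z : Set (ℙ ℂ (σ → ℂ))} {x : ℙ ℂ (σ → ℂ)} :
    x.rep ∈ affineCone Z ↔ x ∈ Z := by
  rw [← mk_mem_iff x.rep_nonzero, Projectivization.mk_rep]

theorem affineCone_mono {Z W : Set (ℙ ℂ (σ → ℂ))} (h : Z ⊆ W) : affineCone Z ⊆ affineCone W :=
  fun _ hv h0 => h (hv h0)

theorem aeval_smul_of_isHomogeneous {K : Type*} [CommRing K] [Algebra ℂ K]
    {p : MvPolynomial σ ℂ} {d : ℕ} (hp : p.IsHomogeneous d) (c : K) (v : σ → K) :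
    aeval (c • v) p = c ^ d * aeval v p := by
  rw [aeval_def, aeval_def, eval₂_eq, eval₂_eq, Finset.mul_sum]
  refine Finset.sum_congr rfl fun m hm => ?_
  have hd : ∑ i ∈ m.support, m i = d := by
    have := hp.degree_eq_sum_deg_support hm
    simpa [Finsupp.degree] using this.symm
  simp only [Pi.smul_apply, smul_eq_mul, mul_pow, Finset.prod_mul_distrib]
  rw [Finset.prod_pow_eq_pow_sum, hd]
  ring

/-- The vanishing ideal of a set stable under scaling is homogeneous: `f (c • v)`, as a polynomial
in `c`, has the values of the homogeneous components of `f` at `v` for coefficients. -/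
theorem homogeneousComponent_mem_vanishingIdeal {V : Set (σ → ℂ)}
    (hV : ∀ v ∈ V, ∀ c : ℂ, c • v ∈ V) {f : MvPolynomial σ ℂ} (hf : f ∈ vanishingIdeal ℂ V)
    (i : ℕ) : homogeneousComponent i f ∈ vanishingIdeal ℂ V := by
  intro v hv
  let q : Polynomial ℂ := ∑ j ∈ Finset.range (f.totalDegree + 1),
    Polynomial.C (aeval v (homogeneousComponent j f)) * Polynomial.X ^ j
  have hq : q = 0 := by
    refine Polynomial.funext fun c => ?_
    have h := hf _ (hV v hv c)
    rw [← sum_homogeneousComponent f, map_sum] at h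
    simp only [fun i c v => aeval_smul_of_isHomogeneous (homogeneousComponent_isHomogeneous i f) c
      (v : σ → ℂ)] at h
    simp only [q, Polynomial.eval_finsetSum, Polynomial.eval_mul, Polynomial.eval_C,
      Polynomial.eval_pow, Polynomial.eval_X, Polynomial.eval_zero]
    rw [← h]
    exact Finset.sum_congr rfl fun j _ => mul_comm _ _
  by_cases hi : i ∈ Finset.range (f.totalDegree + 1)
  · have h := congrArg (fun p => Polynomial.coeff p i) hq
    simpa [q, Polynomial.finsetSum_coeff, Polynomial.coeff_C_mul, Polynomial.coeff_X_pow,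
      Finset.sum_ite_eq, hi, Nat.lt_succ_iff] using h
  · rw [homogeneousComponent_eq_zero _ _ (by simpa [Nat.lt_succ_iff] using hi), map_zero]

theorem coneIdeal_isHomogeneous (Z : Set (ℙ ℂ (σ → ℂ))) :
    (coneIdeal Z).IsHomogeneous (homogeneousSubmodule σ ℂ) := by
  intro i f hf
  have hd : ((DirectSum.decompose (homogeneousSubmodule σ ℂ) f) i : MvPolynomial σ ℂ) =
      homogeneousComponent i f := decomposition.decompose'_apply f i
  rw [hd]
  exact homogeneousComponent_mem_vanishingIdeal (fun v hv c => smul_mem_affineCone hv c) hf i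

theorem smul_mem_zeroLocus {Q : Ideal (MvPolynomial σ ℂ)}
    (hQ : Q.IsHomogeneous (homogeneousSubmodule σ ℂ)) {v : σ → ℂ} (hv : v ∈ zeroLocus ℂ Q)
    (c : ℂ) : c • v ∈ zeroLocus ℂ Q := by
  intro f hf
  rw [← sum_homogeneousComponent f, map_sum]
  refine Finset.sum_eq_zero fun i _ => ?_
  rw [aeval_smul_of_isHomogeneous (homogeneousComponent_isHomogeneous i f),
    hv _ (homogeneousComponent_mem_of_mem hQ hf i), mul_zero]

theorem mk_mem_projZeroLocus {Q : Ideal (MvPolynomial σ ℂ)}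
    (hQ : Q.IsHomogeneous (homogeneousSubmodule σ ℂ)) {v : σ → ℂ} (h : v ≠ 0) :
    Projectivization.mk ℂ v h ∈ projZeroLocus (Q : Set (MvPolynomial σ ℂ)) ↔
      v ∈ zeroLocus ℂ Q := by
  obtain ⟨a, ha⟩ := Projectivization.exists_smul_eq_mk_rep ℂ v h
  have key : Projectivization.mk ℂ v h ∈ projZeroLocus (Q : Set (MvPolynomial σ ℂ)) ↔
      (Projectivization.mk ℂ v h).rep ∈ zeroLocus ℂ Q := by
    simp [projZeroLocus, zeroLocus]
  rw [key]
  constructor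
  · intro hr
    have : v = ((a⁻¹ : ℂˣ) : ℂ) • (Projectivization.mk ℂ v h).rep := by
      rw [← ha, Units.smul_def, smul_smul]; simp
    rw [this]
    exact smul_mem_zeroLocus hQ hr _
  · intro hv
    rw [← ha]
    exact smul_mem_zeroLocus hQ hv _

theorem isClosed_iff_projAlgebraicSets {Z : Set (ℙ ℂ (σ → ℂ))} :
    IsClosed Z ↔ Z ∈ projAlgebraicSets σ := by
  rw [← isOpen_compl_iff]
  change Zᶜᶜ ∈ projAlgebraicSets σ ↔ _
  rw [compl_compl]

theorem isClosed_projZeroLocus {Q : Ideal (MvPolynomial σ ℂ)}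
    (hQ : Q.IsHomogeneous (homogeneousSubmodule σ ℂ)) :
    IsClosed (projZeroLocus (Q : Set (MvPolynomial σ ℂ))) := by
  rw [isClosed_iff_projAlgebraicSets]
  refine ⟨{p | p ∈ Q ∧ ∃ d, p.IsHomogeneous d}, fun p hp => hp.2, ?_⟩
  ext x
  refine ⟨fun hx p hp => hx p hp.1, fun hx p hp => ?_⟩
  rw [← sum_homogeneousComponent p, map_sum]
  exact Finset.sum_eq_zero fun i _ => hx _
    ⟨homogeneousComponent_mem_of_mem hQ hp i, i, homogeneousComponent_isHomogeneous i p⟩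

/-- A closed subset of projective space contains every point at which all polynomials vanish that
vanish on its cone. -/
theorem mem_of_isClosed {Z : Set (ℙ ℂ (σ → ℂ))} (hZ : IsClosed Z) {v : σ → ℂ}
    (hv : v ∈ zeroLocus ℂ (coneIdeal Z)) (h : v ≠ 0) : Projectivization.mk ℂ v h ∈ Z := by
  rw [isClosed_iff_projAlgebraicSets] at hZ
  obtain ⟨S, hS, rfl⟩ := hZ
  intro p hp
  have hpI : p ∈ coneIdeal (projZeroLocus S) := by
    intro w hw
    by_cases hw0 : w = 0
    · obtain ⟨d, hd⟩ := hS p hp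
      -- at the origin a homogeneous polynomial may still be a nonzero constant
      have h1 := hv
      subst hw0
      rcases Nat.eq_zero_or_pos d with rfl | hd0
      · by_contra hne
        have hempty : ∀ x, x ∉ projZeroLocus S := by
          intro x hx
          have h2 := hx p hp
          rw [← totalDegree_zero_iff_isHomogeneous, totalDegree_eq_zero_iff_eq_C] at hd
          rw [hd] at h2 hne
          simp at h2 hne
          exact hne h2
        obtain ⟨i, hi⟩ := Function.ne_iff.mp h
        have hX : (X i : MvPolynomial σ ℂ) ∈ coneIdeal (projZeroLocus S) := by
          intro u hu
          have : u = 0 := by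
            by_contra hu0
            exact hempty _ (hu hu0)
          simp [this]
        exact hi (by simpa using h1 _ hX)
      · have := aeval_smul_of_isHomogeneous hd (0 : ℂ) (0 : σ → ℂ)
        simpa [hd0.ne'] using this
    · have h2 := hw hw0 p hp
      obtain ⟨d, hd⟩ := hS p hp
      obtain ⟨a, ha⟩ := Projectivization.exists_smul_eq_mk_rep ℂ w hw0
      rw [← ha, Units.smul_def, ← coe_aeval_eq_eval] at h2
      have h3 := aeval_smul_of_isHomogeneous hd (a : ℂ) w
      rw [show aeval ((a : ℂ) • w) p = 0 from h2] at h3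
      simpa using h3.symm
  have h4 := (mk_mem_projZeroLocus (coneIdeal_isHomogeneous (projZeroLocus S)) h).mpr hv
  exact h4 p hpI

theorem affineCone_eq_zeroLocus {Z : Set (ℙ ℂ (σ → ℂ))} (hZ : IsClosed Z) :
    affineCone Z = zeroLocus ℂ (coneIdeal Z) := by
  refine Set.Subset.antisymm (fun v hv p hp => hp v hv) fun v hv h => mem_of_isClosed hZ hv h

theorem mem_closure_iff_zeroLocus {Z : Set (ℙ ℂ (σ → ℂ))} {v : σ → ℂ} (h : v ≠ 0) :
    Projectivization.mk ℂ v h ∈ closure Z ↔ v ∈ zeroLocus ℂ (coneIdeal Z) := by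
  constructor
  · intro hv
    have hsub : closure Z ⊆ projZeroLocus (coneIdeal Z : Set (MvPolynomial σ ℂ)) := by
      refine closure_minimal ?_ (isClosed_projZeroLocus (coneIdeal_isHomogeneous Z))
      intro x hx p hp
      rw [← coe_aeval_eq_eval]
      exact hp _ (rep_mem_affineCone.mpr hx)
    exact (mk_mem_projZeroLocus (coneIdeal_isHomogeneous Z) h).mp (hsub hv)
  · intro hv
    refine mem_of_isClosed isClosed_closure ?_ h
    intro p hp
    exact hv p (vanishingIdeal_anti_mono (affineCone_mono subset_closure) hp)

theorem coneIdeal_closure (Z : Set (ℙ ℂ (σ → ℂ))) : coneIdeal (closure Z) = coneIdeal Z := by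
  refine le_antisymm (vanishingIdeal_anti_mono (affineCone_mono subset_closure)) ?_
  intro p hp v hv
  by_cases h : v = 0
  · exact hp v (h ▸ zero_mem_affineCone Z)
  · exact (mem_closure_iff_zeroLocus h).mp (hv h) p hp

theorem coneIdeal_injective_of_isClosed {Z W : Set (ℙ ℂ (σ → ℂ))} (hZ : IsClosed Z)
    (h : coneIdeal Z ≤ coneIdeal W) : W ⊆ Z := by
  intro x hx
  rw [← rep_mem_affineCone, affineCone_eq_zeroLocus hZ]
  intro p hp
  exact h hp _ (rep_mem_affineCone.mpr hx)

/-- The cone over an irreducible set has a prime vanishing ideal. -/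
theorem coneIdeal_isPrime {Z : Set (ℙ ℂ (σ → ℂ))} (hZ : IsIrreducible Z) :
    (coneIdeal Z).IsPrime := by
  refine (coneIdeal_isHomogeneous Z).isPrime_of_homogeneous_mem_or_mem ?_ ?_
  · intro h
    have := (Ideal.eq_top_iff_one _).mp h 0 (zero_mem_affineCone Z)
    simp at this
  · rintro f g ⟨d, hf⟩ ⟨e, hg⟩ hfg
    rw [mem_homogeneousSubmodule] at hf hg
    have hcl : ∀ {q : MvPolynomial σ ℂ} {k : ℕ}, q.IsHomogeneous k → IsClosed (projZeroLocus {q}) :=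
      fun {q k} hq => isClosed_iff_projAlgebraicSets.mpr ⟨{q}, by rintro p rfl; exact ⟨k, hq⟩, rfl⟩
    have hcov : Z ⊆ projZeroLocus {f} ∪ projZeroLocus {g} := by
      intro x hx
      have h := hfg _ (rep_mem_affineCone.mpr hx)
      rw [map_mul, mul_eq_zero] at h
      rcases h with h | h
      · left; rintro p rfl; exact h
      · right; rintro p rfl; exact h
    have key : ∀ {q : MvPolynomial σ ℂ} {k : ℕ}, q.IsHomogeneous k → Z ⊆ projZeroLocus {q} →
        q ∈ coneIdeal Z := by
      intro q k hq hs v hv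
      obtain ⟨x, hx⟩ := hZ.nonempty
      have hmk : ∀ y ∈ Z, aeval y.rep q = 0 := fun y hy => hs hy q rfl
      by_cases h : v = 0
      · have := aeval_smul_of_isHomogeneous hq (0 : ℂ) x.rep
        rw [hmk x hx, mul_zero, zero_smul] at this
        rw [h]
        exact this
      · obtain ⟨a, ha⟩ := Projectivization.exists_smul_eq_mk_rep ℂ v h
        have h2 := hmk _ (hv h)
        rw [← ha, Units.smul_def, aeval_smul_of_isHomogeneous hq] at h2
        simpa using h2
    rcases isPreirreducible_iff_isClosed_union_isClosed.mp hZ.isPreirreducible _ _ (hcl hf) (hcl hg)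
      hcov with h | h
    · exact Or.inl (key hf h)
    · exact Or.inr (key hg h)

/-- The homogeneous Nullstellensatz for primes other than the irrelevant ideal. -/
theorem coneIdeal_projZeroLocus [Finite σ] {Q : Ideal (MvPolynomial σ ℂ)} [hp : Q.IsPrime]
    (hQ : Q.IsHomogeneous (homogeneousSubmodule σ ℂ)) :
    coneIdeal (projZeroLocus (Q : Set (MvPolynomial σ ℂ))) = Q := by
  have h0 : (0 : σ → ℂ) ∈ zeroLocus ℂ Q := by
    by_contra hne
    have hempty : zeroLocus ℂ Q = ∅ := by
      rw [Set.eq_empty_iff_forall_notMem]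
      intro v hv
      have := smul_mem_zeroLocus hQ hv 0
      rw [zero_smul] at this
      exact hne this
    have := IsPrime.vanishingIdeal_zeroLocus (K := ℂ) Q
    rw [hempty, vanishingIdeal_empty] at this
    exact hp.ne_top this.symm
  have : affineCone (projZeroLocus (Q : Set (MvPolynomial σ ℂ))) = zeroLocus ℂ Q := by
    ext v
    by_cases h : v = 0
    · subst h
      exact ⟨fun _ => h0, fun _ => zero_mem_affineCone _⟩
    · rw [← mk_mem_iff h, mk_mem_projZeroLocus hQ h]
  rw [coneIdeal, this, IsPrime.vanishingIdeal_zeroLocus]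

theorem isIrreducible_projZeroLocus [Finite σ] {Q : Ideal (MvPolynomial σ ℂ)} [hp : Q.IsPrime]
    (hQ : Q.IsHomogeneous (homogeneousSubmodule σ ℂ)) {i : σ} (hi : X i ∉ Q) :
    IsIrreducible (projZeroLocus (Q : Set (MvPolynomial σ ℂ))) := by
  have hI := coneIdeal_projZeroLocus hQ
  constructor
  · by_contra hne
    rw [Set.not_nonempty_iff_eq_empty] at hne
    refine hi ?_
    rw [← hI]
    intro v hv
    have : v = 0 := by
      by_contra h
      have := hv h
      rw [hne] at this
      exact this
    simp [this]
  · rw [isPreirreducible_iff_isClosed_union_isClosed]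
    intro Z W hZ hW hcov
    by_contra hcon
    rw [not_or] at hcon
    have h1 : ¬ coneIdeal Z ≤ Q := fun h =>
      hcon.1 (coneIdeal_injective_of_isClosed hZ (h.trans hI.ge))
    have h2 : ¬ coneIdeal W ≤ Q := fun h =>
      hcon.2 (coneIdeal_injective_of_isClosed hW (h.trans hI.ge))
    obtain ⟨f, hf, hfQ⟩ := SetLike.not_le_iff_exists.mp h1
    obtain ⟨g, hg, hgQ⟩ := SetLike.not_le_iff_exists.mp h2
    have : f * g ∈ Q := by
      rw [← hI]
      intro v hv
      rw [map_mul]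
      by_cases h : v = 0
      · rw [hf v (h ▸ zero_mem_affineCone Z), zero_mul]
      · rcases hcov (hv h) with h' | h'
        · rw [hf v fun _ => h', zero_mul]
        · rw [hg v fun _ => h', mul_zero]
    exact (hp.mem_or_mem this).elim hfQ hgQ

end Cone

/-! ### Dimension and transcendence degree -/

/-- A proper quotient of a finitely generated domain has smaller transcendence degree. -/
theorem trdeg_lt_of_surjective_of_not_injective {A B : Type} [CommRing A] [CommRing B] [IsDomain A]
    [IsDomain B] [Algebra ℂ A] [Algebra ℂ B] [Algebra.FiniteType ℂ A] (f : A →ₐ[ℂ] B)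
    (hf : Function.Surjective f) (hinj : ¬ Function.Injective f) :
    Algebra.trdeg ℂ B < Algebra.trdeg ℂ A := by
  by_contra hcon
  rw [not_lt] at hcon
  obtain ⟨s, hs⟩ := exists_isTranscendenceBasis ℂ B
  have hlift : ∀ b : s, ∃ a : A, f a = b := fun b => hf b
  choose a ha using hlift
  have hfa : f ∘ a = ((↑) : s → B) := funext ha
  have hind : AlgebraicIndependent ℂ a := AlgebraicIndependent.of_comp f (by rw [hfa]; exact hs.1)
  have hfin : Algebra.trdeg ℂ A < Cardinal.aleph0 := trdeg_lt_aleph0_of_finiteType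
  have hbas : IsTranscendenceBasis ℂ a :=
    hind.isTranscendenceBasis_of_trdeg_le hfin (by rwa [hs.cardinalMk_eq_trdeg])
  have halg := hbas.isAlgebraic
  have hker : RingHom.ker f ≠ ⊥ := fun h => hinj ((RingHom.injective_iff_ker_eq_bot f).mpr h)
  obtain ⟨x, hx, hx0⟩ := Submodule.exists_mem_ne_zero_of_ne_bot hker
  have hne := Ideal.comap_ne_bot_of_algebraic_mem hx0 hx (halg.isAlgebraic x)
  obtain ⟨y, hy, hy0⟩ := Submodule.exists_mem_ne_zero_of_ne_bot hne
  obtain ⟨⟨y, hyS⟩, rfl⟩ : ∃ z, z = y := ⟨y, rfl⟩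
  rw [Algebra.adjoin_range_eq_range_aeval] at hyS
  obtain ⟨p, rfl⟩ := hyS
  have h1 : f (aeval a p) = 0 := hy
  rw [← AlgHom.comp_apply, comp_aeval] at h1
  have h2 : p = 0 := by
    have hi := hs.1
    rw [algebraicIndependent_iff] at hi
    exact hi p (by rw [← h1]; congr 2; exact hfa.symm)
  refine hy0 (Subtype.ext ?_)
  simp [h2]

theorem trdeg_quotient_lt_of_lt {σ : Type} [Finite σ] {P Q : Ideal (MvPolynomial σ ℂ)} [P.IsPrime]
    [Q.IsPrime] (h : P < Q) :
    Algebra.trdeg ℂ (MvPolynomial σ ℂ ⧸ Q) < Algebra.trdeg ℂ (MvPolynomial σ ℂ ⧸ P) := by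
  refine trdeg_lt_of_surjective_of_not_injective (Ideal.Quotient.factorₐ ℂ h.le)
    (Ideal.Quotient.factor_surjective h.le) fun hinj => ?_
  obtain ⟨x, hxQ, hxP⟩ := SetLike.exists_of_lt h
  refine hxP (Ideal.Quotient.eq_zero_iff_mem.mp (hinj ?_))
  rw [map_zero]
  exact Ideal.Quotient.eq_zero_iff_mem.mpr hxQ

/-- A finitely generated domain over `ℂ` has a chain of primes of length its transcendence degree:
Noether normalization and going up. -/
theorem exists_ltSeries_length_eq_trdeg {B : Type} [CommRing B] [IsDomain B] [Algebra ℂ B]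
    [Algebra.FiniteType ℂ B] :
    ∃ l : LTSeries (PrimeSpectrum B), (l.length : Cardinal) = Algebra.trdeg ℂ B := by
  obtain ⟨s, g, hg, hint⟩ := exists_integral_inj_algHom_of_fg ℂ B
  algebraize [g.toRingHom]
  have hfaith : FaithfulSMul (MvPolynomial (Fin s) ℂ) B :=
    (faithfulSMul_iff_algebraMap_injective _ _).mpr hg
  have hint' : Algebra.IsIntegral (MvPolynomial (Fin s) ℂ) B := ⟨hint⟩
  have htr : Algebra.trdeg ℂ B = s := by
    rw [← trdeg_add_eq ℂ (MvPolynomial (Fin s) ℂ) (A := B),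
      trdeg_eq_zero (R := MvPolynomial (Fin s) ℂ)]
    simp
  have hdim : ringKrullDim (MvPolynomial (Fin s) ℂ) = s := by simp
  obtain ⟨l, hl⟩ := Order.le_krullDim_iff.mp (show ((s : ℕ) : WithBot ℕ∞) ≤
    Order.krullDim (PrimeSpectrum (MvPolynomial (Fin s) ℂ)) from hdim.ge)
  obtain ⟨P, hPp, hPo⟩ : ∃ P : Ideal B, P.IsPrime ∧ P.LiesOver l.head.asIdeal := by
    obtain ⟨P, h1, h2, h3⟩ := Ideal.exists_ideal_over_prime_of_isIntegral (S := B) l.head.asIdeal ⊥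
      (by exact Ideal.comap_bot_le_of_injective _ hg)
    exact ⟨P, h2, ⟨h3.symm⟩⟩
  obtain ⟨L, hL, -⟩ := Ideal.exists_ltSeries_of_hasGoingUp l P
  exact ⟨L, by rw [hL, hl, htr]⟩

/-- Every prime ideal is the ideal of all relations of some point over a field extension of `ℂ`. -/
theorem exists_generic_point {σ : Type} (P : Ideal (MvPolynomial σ ℂ)) [P.IsPrime] :
    ∃ (F : Type) (_ : Field F) (_ : Algebra ℂ F) (x : σ → F),
      ∀ p : MvPolynomial σ ℂ, aeval x p = 0 ↔ p ∈ P := by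
  refine ⟨FractionRing (MvPolynomial σ ℂ ⧸ P), inferInstance, inferInstance,
    fun j => algebraMap _ _ (Ideal.Quotient.mk P (X j)), fun p => ?_⟩
  have : aeval (fun j => algebraMap _ (FractionRing (MvPolynomial σ ℂ ⧸ P))
      (Ideal.Quotient.mk P (X j))) =
      (IsScalarTower.toAlgHom ℂ (MvPolynomial σ ℂ ⧸ P) _).comp (Ideal.Quotient.mkₐ ℂ P) := by
    ext j; simp
  rw [this, AlgHom.comp_apply, IsScalarTower.coe_toAlgHom', IsFractionRing.to_map_eq_zero_iff]
  exact Ideal.Quotient.eq_zero_iff_mem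

section Chart

variable {σ : Type} {F : Type} [Field F] [Algebra ℂ F]

/-- Evaluation of polynomials at the coordinates `x_j / x_i` of a point in the chart `x_i ≠ 0`. -/
noncomputable def chartHom (x : σ → F) (i : σ) : MvPolynomial σ ℂ →ₐ[ℂ] F :=
  aeval ((x i)⁻¹ • x)

variable {x : σ → F} {i : σ}

theorem chartHom_X_self (hx : x i ≠ 0) : chartHom x i (X i) = 1 := by
  simp [chartHom, hx]

theorem trdeg_le_trdeg_chart_add_one {P : Ideal (MvPolynomial σ ℂ)}
    (hP : ∀ p : MvPolynomial σ ℂ, aeval x p = 0 ↔ p ∈ P) (hx : x i ≠ 0) :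
    Algebra.trdeg ℂ (MvPolynomial σ ℂ ⧸ P) ≤ Algebra.trdeg ℂ (chartHom x i).range + 1 := by
  let B := (chartHom x i).range
  let T : Subalgebra B F := (Polynomial.aeval (R := B) (x i)).range
  have hfB : FaithfulSMul ℂ B :=
    (faithfulSMul_iff_algebraMap_injective _ _).mpr (algebraMap ℂ B).injective
  have hfT : FaithfulSMul B T :=
    (faithfulSMul_iff_algebraMap_injective _ _).mpr fun a b hab => by
      have := congrArg (Subtype.val : T → F) hab
      exact Subtype.ext this
  have h2 : Algebra.trdeg ℂ B + Algebra.trdeg B T = Algebra.trdeg ℂ T := trdeg_add_eq ℂ B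
  have h3 : Algebra.trdeg B T ≤ 1 := by
    rw [← Polynomial.trdeg_of_isDomain (R := B)]
    exact trdeg_le_of_surjective (Polynomial.aeval (R := B) (x i)).rangeRestrict
      (AlgHom.rangeRestrict_surjective _)
  have hgen : ∀ j, x j ∈ T.restrictScalars ℂ := by
    intro j
    have hB : (x i)⁻¹ * x j ∈ B := ⟨X j, by simp [chartHom]⟩
    refine ⟨Polynomial.C ⟨_, hB⟩ * Polynomial.X, ?_⟩
    have h5 : algebraMap B F ⟨(x i)⁻¹ * x j, hB⟩ = (x i)⁻¹ * x j := rfl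
    simp [h5]
    field_simp
  have hle : ∀ p : MvPolynomial σ ℂ, aeval x p ∈ T.restrictScalars ℂ := by
    intro p
    have hle' : Algebra.adjoin ℂ (Set.range x) ≤ T.restrictScalars ℂ := by
      refine Algebra.adjoin_le ?_
      rintro _ ⟨j, rfl⟩
      exact hgen j
    exact hle' (by rw [Algebra.adjoin_range_eq_range_aeval]; exact ⟨p, rfl⟩)
  have h1 : Algebra.trdeg ℂ (MvPolynomial σ ℂ ⧸ P) ≤ Algebra.trdeg ℂ (T.restrictScalars ℂ) := by
    refine trdeg_le_of_injective (Ideal.Quotient.liftₐ P ((aeval x).codRestrict _ hle)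
      fun p hp => Subtype.ext ((hP p).mpr hp)) ?_
    rw [injective_iff_map_eq_zero]
    intro a ha
    obtain ⟨p, rfl⟩ := Ideal.Quotient.mk_surjective a
    exact Ideal.Quotient.eq_zero_iff_mem.mpr ((hP p).mp (congrArg Subtype.val ha))
  calc _ ≤ Algebra.trdeg ℂ T := h1
    _ = Algebra.trdeg ℂ B + Algebra.trdeg B T := h2.symm
    _ ≤ _ := by gcongr

theorem chartHom_eq_zero_of_mem {P : Ideal (MvPolynomial σ ℂ)}
    (hP : ∀ p : MvPolynomial σ ℂ, aeval x p = 0 ↔ p ∈ P)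
    (hPh : P.IsHomogeneous (homogeneousSubmodule σ ℂ)) {f : MvPolynomial σ ℂ} (hf : f ∈ P) :
    chartHom x i f = 0 := by
  rw [chartHom, ← sum_homogeneousComponent f, map_sum]
  refine Finset.sum_eq_zero fun k _ => ?_
  rw [aeval_smul_of_isHomogeneous (homogeneousComponent_isHomogeneous k f),
    (hP _).mpr (homogeneousComponent_mem_of_mem hPh hf k), mul_zero]

/-- Among the ideals containing `X i - 1`, taking the homogeneous core is strictly monotone, since
multiplication by powers of `X i` homogenizes polynomials without changing them modulo
`X i - 1`. -/
theorem homogeneousCore_lt_of_lt {Q Q' : Ideal (MvPolynomial σ ℂ)} (h : Q < Q')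
    (hQ : X i - 1 ∈ Q) :
    (Q.homogeneousCore (homogeneousSubmodule σ ℂ)).toIdeal <
      (Q'.homogeneousCore (homogeneousSubmodule σ ℂ)).toIdeal := by
  refine lt_of_le_of_ne (Ideal.homogeneousCore_mono _ h.le) fun heq => ?_
  obtain ⟨f, hfQ', hfQ⟩ := SetLike.exists_of_lt h
  let g : MvPolynomial σ ℂ := ∑ k ∈ Finset.range (f.totalDegree + 1),
    homogeneousComponent k f * X i ^ (f.totalDegree - k)
  have hg : g.IsHomogeneous f.totalDegree := by
    refine IsHomogeneous.sum _ _ _ fun k hk => ?_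
    have hk' : k ≤ f.totalDegree := by simpa [Nat.lt_succ_iff] using hk
    have := (homogeneousComponent_isHomogeneous k f).mul
      (isHomogeneous_X_pow (R := ℂ) i (f.totalDegree - k))
    rwa [Nat.add_sub_cancel' hk'] at this
  have hfg : g - f ∈ Q := by
    have : g - f = ∑ k ∈ Finset.range (f.totalDegree + 1),
        homogeneousComponent k f * (X i ^ (f.totalDegree - k) - 1) := by
      simp only [mul_sub, mul_one, Finset.sum_sub_distrib, g, sum_homogeneousComponent]
    rw [this]
    refine Ideal.sum_mem _ fun k _ => Ideal.mul_mem_left _ _ ?_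
    exact Ideal.mem_of_dvd _ (by simpa using sub_dvd_pow_sub_pow (X i : MvPolynomial σ ℂ) 1 _) hQ
  have hgQ' : g ∈ Q' := by
    have := Ideal.add_mem _ (h.le hfg) hfQ'
    simpa using this
  have hgcore : g ∈ (Q'.homogeneousCore (homogeneousSubmodule σ ℂ)).toIdeal :=
    Ideal.mem_homogeneousCore_of_homogeneous_of_mem ⟨_, hg⟩ hgQ'
  rw [← heq] at hgcore
  have hgQ := Ideal.toIdeal_homogeneousCore_le _ _ hgcore
  exact hfQ (by simpa using Ideal.sub_mem _ hgQ hfg)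

end Chart

/-- An irreducible closed subset of a topological space as an irreducible closed subset of a
subspace containing it. -/
def restrictIrreducibleClosed {X : Type} [TopologicalSpace X] {Z W : Set X} (hc : IsClosed W)
    (hi : IsIrreducible W) (h : W ⊆ Z) : TopologicalSpace.IrreducibleCloseds Z where
  carrier := Subtype.val ⁻¹' W
  isIrreducible' := by
    obtain ⟨⟨y, hy⟩, hpre⟩ := hi
    refine ⟨⟨⟨y, h hy⟩, hy⟩, ?_⟩
    rintro _ _ ⟨u, hu, rfl⟩ ⟨v, hv, rfl⟩ ⟨a, ha, hau⟩ ⟨b, hb, hbv⟩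
    obtain ⟨c, hc, hcu, hcv⟩ := hpre u v hu hv ⟨a, ha, hau⟩ ⟨b, hb, hbv⟩
    exact ⟨⟨c, h hc⟩, hc, hcu, hcv⟩
  isClosed' := hc.preimage continuous_subtype_val

theorem image_restrictIrreducibleClosed {X : Type} [TopologicalSpace X] {Z W : Set X}
    (hc : IsClosed W) (hi : IsIrreducible W) (h : W ⊆ Z) :
    Subtype.val '' (restrictIrreducibleClosed hc hi h : Set Z) = W := by
  change Subtype.val '' (Subtype.val ⁻¹' W) = W
  rw [Subtype.image_preimage_coe, Set.inter_eq_right.mpr h]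

section Dim

variable {σ : Type}

theorem isIrreducible_image_coe {Z : Set (ℙ ℂ (σ → ℂ))}
    (W : TopologicalSpace.IrreducibleCloseds Z) :
    IsIrreducible ((↑) '' (W : Set Z) : Set (ℙ ℂ (σ → ℂ))) :=
  W.isIrreducible.image _ continuous_subtype_val.continuousOn

/-- A variety whose ideal is homogeneous and does not contain all the coordinates is not a point. -/
theorem trdeg_quotient_ne_zero {P : Ideal (MvPolynomial σ ℂ)} [P.IsPrime] {i : σ} (hi : X i ∉ P)
    (hP : P.IsHomogeneous (homogeneousSubmodule σ ℂ)) :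
    Algebra.trdeg ℂ (MvPolynomial σ ℂ ⧸ P) ≠ 0 := by
  rw [trdeg_ne_zero_iff]
  refine ⟨Ideal.Quotient.mk P (X i), ?_⟩
  rintro ⟨p, hp0, hp⟩
  -- an algebraic equation for `X i` over `ℂ` forces a power of `X i` into the homogeneous ideal
  have hp' : Polynomial.aeval (X i : MvPolynomial σ ℂ) p ∈ P := by
    rw [← Ideal.Quotient.eq_zero_iff_mem, ← hp]
    exact (Polynomial.aeval_algHom_apply (Ideal.Quotient.mkₐ ℂ P) (X i) p).symm
  have hc := homogeneousComponent_mem_of_mem hP hp' p.natDegree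
  have : homogeneousComponent p.natDegree (Polynomial.aeval (X i : MvPolynomial σ ℂ) p) =
      C p.leadingCoeff * X i ^ p.natDegree := by
    rw [Polynomial.aeval_eq_sum_range, map_sum, Finset.sum_eq_single p.natDegree]
    · rw [smul_eq_C_mul, homogeneousComponent_C_mul,
        homogeneousComponent_of_mem (isHomogeneous_X_pow i _)]
      simp
    · intro k hk hne
      rw [smul_eq_C_mul, homogeneousComponent_C_mul,
        homogeneousComponent_of_mem (isHomogeneous_X_pow i _), if_neg hne.symm, mul_zero]
    · simp
  rw [this] at hc
  rcases Ideal.IsPrime.mem_or_mem ‹_› hc with h | h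
  · have hu : IsUnit (C p.leadingCoeff : MvPolynomial σ ℂ) :=
      (isUnit_iff_ne_zero.mpr (Polynomial.leadingCoeff_ne_zero.mpr hp0)).map C
    exact Ideal.IsPrime.ne_top ‹_› (Ideal.eq_top_of_isUnit_mem _ h hu)
  · exact hi (Ideal.IsPrime.mem_of_pow_mem ‹_› _ h)

theorem exists_X_notMem_coneIdeal {Z : Set (ℙ ℂ (σ → ℂ))} (hZ : Z.Nonempty) :
    ∃ i, X i ∉ coneIdeal Z := by
  obtain ⟨x, hx⟩ := hZ
  obtain ⟨i, hi⟩ := Function.ne_iff.mp x.rep_nonzero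
  refine ⟨i, fun h => hi ?_⟩
  simpa using h _ (rep_mem_affineCone.mpr hx)

/-- The dimension of a projective variety is one less than the transcendence degree of its
homogeneous coordinate ring. -/
theorem exists_topologicalKrullDim_eq_trdeg [Finite σ] {Z : Set (ℙ ℂ (σ → ℂ))} (hZ : IsClosed Z)
    (hne : Z.Nonempty) (hP : (coneIdeal Z).IsPrime) :
    ∃ d : ℕ, topologicalKrullDim Z = d ∧
      Algebra.trdeg ℂ (MvPolynomial σ ℂ ⧸ coneIdeal Z) = (d + 1 : ℕ) := by
  obtain ⟨i, hi⟩ := exists_X_notMem_coneIdeal hne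
  have hfin : ∀ Q : Ideal (MvPolynomial σ ℂ),
      Algebra.trdeg ℂ (MvPolynomial σ ℂ ⧸ Q) < Cardinal.aleph0 := fun Q =>
    trdeg_lt_aleph0_of_finiteType
  obtain ⟨e, he⟩ := Cardinal.lt_aleph0.mp (hfin (coneIdeal Z))
  have he0 : e ≠ 0 := by
    have := trdeg_quotient_ne_zero hi (coneIdeal_isHomogeneous Z)
    rw [he] at this
    exact_mod_cast this
  obtain ⟨d, rfl⟩ := Nat.exists_eq_succ_of_ne_zero he0
  refine ⟨d, le_antisymm ?_ ?_, he⟩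
  · -- transcendence degree is strictly monotone on irreducible closed subsets
    let t : TopologicalSpace.IrreducibleCloseds Z → ℕ := fun W =>
      Cardinal.toNat (Algebra.trdeg ℂ (MvPolynomial σ ℂ ⧸
        coneIdeal ((↑) '' (W : Set Z) : Set (ℙ ℂ (σ → ℂ)))))
    have hpr : ∀ W : TopologicalSpace.IrreducibleCloseds Z,
        (coneIdeal ((↑) '' (W : Set Z) : Set (ℙ ℂ (σ → ℂ)))).IsPrime := fun W =>
      coneIdeal_isPrime (isIrreducible_image_coe W)
    have hcl : ∀ W : TopologicalSpace.IrreducibleCloseds Z,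
        IsClosed ((↑) '' (W : Set Z) : Set (ℙ ℂ (σ → ℂ))) := fun W =>
      hZ.isClosedEmbedding_subtypeVal.isClosedMap _ W.isClosed
    have hmono : StrictMono t := by
      intro V W hVW
      have hlt : coneIdeal ((↑) '' (W : Set Z) : Set (ℙ ℂ (σ → ℂ))) <
          coneIdeal ((↑) '' (V : Set Z) : Set (ℙ ℂ (σ → ℂ))) := by
        refine lt_of_le_of_ne (vanishingIdeal_anti_mono (affineCone_mono
          (Set.image_mono hVW.le))) fun heq => hVW.not_ge ?_
        have := coneIdeal_injective_of_isClosed (hcl V) heq.ge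
        exact (Set.image_subset_image_iff Subtype.val_injective).mp this
      have := hpr V
      have := hpr W
      exact Cardinal.toNat_lt_toNat (trdeg_quotient_lt_of_lt hlt) (hfin _)
    have hpos : ∀ W, t W ≠ 0 := by
      intro W h
      have := hpr W
      obtain ⟨j, hj⟩ := exists_X_notMem_coneIdeal (isIrreducible_image_coe W).nonempty
      have h2 := trdeg_quotient_ne_zero hj (coneIdeal_isHomogeneous _)
      rcases Cardinal.toNat_eq_zero.mp h with h3 | h3
      · exact h2 h3
      · exact (hfin _).not_ge h3
    have hle : ∀ W, t W ≤ d + 1 := by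
      intro W
      have h1 : Algebra.trdeg ℂ (MvPolynomial σ ℂ ⧸
          coneIdeal ((↑) '' (W : Set Z) : Set (ℙ ℂ (σ → ℂ)))) ≤ (d + 1 : ℕ) := by
        rw [← Nat.succ_eq_add_one, ← he]
        have hsub : coneIdeal Z ≤ coneIdeal ((↑) '' (W : Set Z) : Set (ℙ ℂ (σ → ℂ))) :=
          vanishingIdeal_anti_mono (affineCone_mono (by rintro _ ⟨x, -, rfl⟩; exact x.2))
        exact trdeg_le_of_surjective (Ideal.Quotient.factorₐ ℂ hsub)
          (Ideal.Quotient.factor_surjective hsub)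
      have := Cardinal.toNat_le_toNat h1 (Cardinal.natCast_lt_aleph0)
      rwa [Cardinal.toNat_natCast] at this
    unfold topologicalKrullDim
    refine iSup_le fun l => ?_
    have hl : ∀ k : Fin (l.length + 1), (k : ℕ) + 1 ≤ t (l k) := by
      intro k
      induction k using Fin.induction with
      | zero => exact Nat.one_le_iff_ne_zero.mpr (hpos _)
      | succ k ih =>
        have := hmono (l.step k)
        simp only [Fin.val_succ, Fin.val_castSucc] at ih ⊢
        omega
    have := (hl (Fin.last _)).trans (hle _)
    simp only [Fin.val_last] at this
    exact_mod_cast Nat.le_of_succ_le_succ this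
  · obtain ⟨F, _, _, x, hx⟩ := exists_generic_point (coneIdeal Z)
    have hx0 : x i ≠ 0 := fun h => hi ((hx _).mp (by simpa using h))
    have hft : Algebra.FiniteType ℂ (chartHom x i).range :=
      Algebra.FiniteType.of_surjective (chartHom x i).rangeRestrict
        (AlgHom.rangeRestrict_surjective _)
    obtain ⟨l, hl⟩ := exists_ltSeries_length_eq_trdeg (B := (chartHom x i).range)
    have hlen : d ≤ l.length := by
      have := trdeg_le_trdeg_chart_add_one hx hx0
      rw [he, ← hl] at this
      have : d + 1 ≤ l.length + 1 := by exact_mod_cast this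
      omega
    let ψ := (chartHom x i).rangeRestrict
    have hψ : Function.Surjective ψ := AlgHom.rangeRestrict_surjective _
    let q : PrimeSpectrum (chartHom x i).range → Ideal (MvPolynomial σ ℂ) :=
      fun p => p.asIdeal.comap ψ
    have hq1 : ∀ p, X i - 1 ∈ q p := by
      intro p
      have : ψ (X i - 1) = 0 := by
        apply Subtype.ext
        change chartHom x i (X i - 1) = 0
        rw [map_sub, chartHom_X_self hx0, map_one, sub_self]
      simp [q, Ideal.mem_comap, this]
    let c : PrimeSpectrum (chartHom x i).range → Ideal (MvPolynomial σ ℂ) :=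
      fun p => ((q p).homogeneousCore (homogeneousSubmodule σ ℂ)).toIdeal
    have hcp : ∀ p, (c p).IsPrime := fun p => (Ideal.IsPrime.comap ψ).homogeneousCore
    have hch : ∀ p, (c p).IsHomogeneous (homogeneousSubmodule σ ℂ) := fun p =>
      HomogeneousIdeal.isHomogeneous _
    have hci : ∀ p, X i ∉ c p := by
      intro p h
      have h1 := Ideal.toIdeal_homogeneousCore_le _ _ h
      have h2 := Ideal.sub_mem _ h1 (hq1 p)
      rw [sub_sub_cancel] at h2
      exact (Ideal.IsPrime.comap ψ (K := p.asIdeal)).ne_top ((Ideal.eq_top_iff_one _).mpr h2)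
    have hcZ : ∀ p, coneIdeal Z ≤ c p := by
      intro p
      rw [← (coneIdeal_isHomogeneous Z).toIdeal_homogeneousCore_eq_self]
      refine Ideal.homogeneousCore_mono _ fun f hf => ?_
      have h1 := chartHom_eq_zero_of_mem (i := i) hx (coneIdeal_isHomogeneous Z) hf
      have : ψ f = 0 := Subtype.ext h1
      simp [q, Ideal.mem_comap, this]
    have hcm : StrictMono c := by
      intro p p' hpp
      refine homogeneousCore_lt_of_lt (i := i) ?_ (hq1 p)
      refine lt_of_le_of_ne (Ideal.comap_mono hpp.le) fun heq => hpp.ne ?_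
      exact PrimeSpectrum.ext (Ideal.comap_injective_of_surjective ψ hψ heq)
    have hsub : ∀ p, projZeroLocus (c p : Set (MvPolynomial σ ℂ)) ⊆ Z := by
      intro p
      have := hcp p
      refine coneIdeal_injective_of_isClosed hZ ?_
      rw [coneIdeal_projZeroLocus (hch p)]
      exact hcZ p
    let V : PrimeSpectrum (chartHom x i).range → TopologicalSpace.IrreducibleCloseds Z := fun p =>
      restrictIrreducibleClosed (isClosed_projZeroLocus (hch p))
        (have := hcp p; isIrreducible_projZeroLocus (hch p) (hci p)) (hsub p)
    have hV : StrictAnti V := by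
      intro p p' hpp
      refine lt_of_le_of_ne (fun x hx f hf => hx f ((hcm hpp).le hf)) fun heq => (hcm hpp).ne ?_
      have h1 : projZeroLocus (c p' : Set (MvPolynomial σ ℂ)) =
          projZeroLocus (c p : Set (MvPolynomial σ ℂ)) := by
        have := congrArg (fun W : TopologicalSpace.IrreducibleCloseds Z =>
          ((↑) '' (W : Set Z) : Set (ℙ ℂ (σ → ℂ)))) heq
        have himg : ∀ p, ((↑) '' (V p : Set Z) : Set (ℙ ℂ (σ → ℂ))) =
            projZeroLocus (c p : Set (MvPolynomial σ ℂ)) := by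
          intro p
          exact image_restrictIrreducibleClosed _ _ _
        simpa [himg] using this
      have := hcp p
      have := hcp p'
      exact (coneIdeal_projZeroLocus (hch p)).symm.trans
        ((congrArg coneIdeal h1.symm).trans (coneIdeal_projZeroLocus (hch p')))
    have h3 : ((l.length : ℕ) : WithBot ℕ∞) ≤ topologicalKrullDim Z := by
      unfold topologicalKrullDim
      exact Order.LTSeries.length_le_krullDim
        { length := l.length
          toFun := fun k => V (l k.rev)
          step := fun k => by
            rw [Fin.rev_castSucc, Fin.rev_succ]
            exact hV (l.step k.rev) }
    exact le_trans (by exact_mod_cast hlen) h3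

end Dim

/-! ### Derivations of field extensions -/

section Derivations

variable {K : Type} [Field K] [Algebra ℂ K]

/-- In characteristic zero a derivation vanishing on a subring vanishes on all elements algebraic
over it. The ring `R` need not be a domain; what matters is its image in the field `K`. -/
theorem Derivation.eq_zero_of_isAlgebraic {R : Type} [CommRing R] [Algebra ℂ R] [Algebra R K]
    [IsScalarTower ℂ R K] (D : Derivation ℂ R K) (hker : ∀ r, algebraMap R K r = 0 → D r = 0)
    (S : Subalgebra ℂ R) (hS : ∀ s ∈ S, D s = 0) (hinj : ∀ s ∈ S, algebraMap R K s = 0 → s = 0)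
    {a : R} (ha : IsAlgebraic S (algebraMap R K a)) : D a = 0 := by
  classical
  have hex : ∃ n, ∃ p : Polynomial S, p ≠ 0 ∧ Polynomial.aeval (algebraMap R K a) p = 0 ∧
      p.natDegree = n := by
    obtain ⟨p, hp0, hp⟩ := ha
    exact ⟨_, p, hp0, hp, rfl⟩
  obtain ⟨p, hp0, hp, hdeg⟩ := Nat.find_spec hex
  have hmin := fun m (hm : m < Nat.find hex) => Nat.find_min hex hm
  let D' : Derivation S R K :=
    { toFun := D
      map_add' := D.map_add
      map_smul' := fun s r => by
        change D ((s : R) * r) = _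
        rw [D.leibniz, hS s s.2, smul_zero, add_zero]
        rfl
      map_one_eq_zero' := D.map_one_eq_zero
      leibniz' := D.leibniz }
  have hinjS : Function.Injective (algebraMap S K) := by
    rw [injective_iff_map_eq_zero]
    intro s hs
    exact Subtype.ext (hinj s s.2 hs)
  have hSd : IsDomain S := hinjS.isDomain _
  have hSc : CharZero S := charZero_of_injective_algebraMap (algebraMap ℂ S).injective
  have h1 : D' (Polynomial.aeval a p) = Polynomial.aeval a (Polynomial.derivative p) • D' a :=
    D'.map_aeval p a
  have h2 : D' (Polynomial.aeval a p) = 0 := by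
    refine hker _ ?_
    rw [← Polynomial.aeval_algebraMap_apply]
    exact hp
  have h3 : Polynomial.aeval (algebraMap R K a) (Polynomial.derivative p) ≠ 0 := by
    intro h0
    have hnd : p.natDegree ≠ 0 := by
      intro hn
      rw [Polynomial.eq_C_of_natDegree_eq_zero hn, Polynomial.aeval_C] at hp
      have hc := hinjS (hp.trans (map_zero _).symm)
      refine hp0 ?_
      rw [Polynomial.eq_C_of_natDegree_eq_zero hn, hc, Polynomial.C_0]
    have hlt := Polynomial.natDegree_derivative_lt hnd
    rw [hdeg] at hlt
    refine hmin _ hlt ⟨_, fun hd => hnd ?_, h0, rfl⟩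
    exact Polynomial.derivative_eq_zero.mp hd
  rw [h2, ← algebraMap_smul K (Polynomial.aeval a (Polynomial.derivative p)),
    ← Polynomial.aeval_algebraMap_apply] at h1
  exact (smul_eq_zero.mp h1.symm).resolve_left h3

/-- Derivations of an extension field of `ℂ` can be prescribed freely on an algebraically
independent family. -/
theorem AlgebraicIndependent.exists_derivation {ι : Type} {b : ι → K}
    (hb : AlgebraicIndependent ℂ b) (u : ι → K) : ∃ D : Derivation ℂ K K, ∀ i, D (b i) = u i := by
  classical
  obtain ⟨t, hst, ht⟩ := exists_isTranscendenceBasis_superset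
    ((algebraicIndependent_subtype_range hb.injective).mpr hb : AlgebraicIndepOn ℂ id (Set.range b))
  let P := MvPolynomial t ℂ
  algebraize [(aeval (R := ℂ) (Subtype.val : t → K)).toRingHom]
  have htow : IsScalarTower ℂ P K := IsScalarTower.of_algebraMap_eq' (by
    ext r; exact ((aeval (R := ℂ) (Subtype.val : t → K)).commutes r).symm)
  have hX : ∀ i : t, algebraMap P K (X i) = i := fun i => aeval_X _ i
  have hinj : Function.Injective (algebraMap P K) := ht.1
  have hfaith : FaithfulSMul P K := (faithfulSMul_iff_algebraMap_injective _ _).mpr hinj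
  have halgP : Algebra.IsAlgebraic P K := by
    have h1 : Algebra.IsAlgebraic (Algebra.adjoin ℂ (Set.range (Subtype.val : t → K))) K :=
      ht.isAlgebraic
    exact Algebra.IsAlgebraic.of_ringHom_of_comp_eq (ht.1.aevalEquiv.toRingEquiv.toRingHom)
      (RingHom.id K) ht.1.aevalEquiv.surjective Function.injective_id
      (RingHom.ext fun p => ht.1.algebraMap_aevalEquiv p)
  let L := FractionRing P
  let _ : Algebra L K := FractionRing.liftAlgebra P K
  have htower : IsScalarTower P L K := FractionRing.isScalarTower_liftAlgebra P K
  have halg : Algebra.IsAlgebraic L K := (IsFractionRing.comap_isAlgebraic_iff (A := P)).mp halgP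
  have he1 : Algebra.FormallyEtale P L :=
    Algebra.FormallyEtale.of_isLocalization (nonZeroDivisors P)
  have he2 : Algebra.FormallyEtale L K := Algebra.FormallyEtale.of_isSeparable L K
  have he : Algebra.FormallyEtale P K := Algebra.FormallyEtale.comp P L K
  let v : t → K := fun i => if h : ∃ j, b j = i then u h.choose else 0
  let D₀ : Derivation ℂ P K := mkDerivation ℂ v
  have hbc := KaehlerDifferential.isBaseChange_of_formallyEtale ℂ P K
  refine ⟨(hbc.lift D₀.liftKaehlerDifferential).compDer (KaehlerDifferential.D ℂ K), fun i => ?_⟩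
  have hbi : b i ∈ t := hst ⟨i, rfl⟩
  have h1 : b i = algebraMap P K (X ⟨b i, hbi⟩) := (hX ⟨b i, hbi⟩).symm
  have h2 : KaehlerDifferential.D ℂ K (b i) =
      KaehlerDifferential.map ℂ ℂ P K (KaehlerDifferential.D ℂ P (X ⟨b i, hbi⟩)) := by
    rw [KaehlerDifferential.map_D, ← h1]
  have h3 : hbc.lift D₀.liftKaehlerDifferential (KaehlerDifferential.D ℂ K (b i)) =
      v ⟨b i, hbi⟩ := by
    rw [h2, hbc.lift_eq, Derivation.liftKaehlerDifferential_comp_D]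
    exact mkDerivation_X _ _ _
  change hbc.lift D₀.liftKaehlerDifferential (KaehlerDifferential.D ℂ K (b i)) = u i
  rw [h3]
  have hex : ∃ j, b j = b i := ⟨i, rfl⟩
  simp only [v, dif_pos hex]
  exact congrArg u (hb.injective hex.choose_spec)

/-- The chain rule for a derivation applied to a polynomial expression. -/
theorem Derivation.map_mvPolynomial_aeval {A τ : Type} [CommRing A] [Algebra ℂ A] [Fintype τ]
    (D : Derivation ℂ A A) (φ : τ → A) (f : MvPolynomial τ ℂ) :
    D (aeval φ f) = ∑ i, aeval φ (pderiv i f) * D (φ i) := by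
  classical
  induction f using MvPolynomial.induction_on with
  | C a => simp
  | add p q hp hq => simp [hp, hq, add_mul, Finset.sum_add_distrib]
  | mul_X p j hp =>
    simp only [map_mul, aeval_X, D.leibniz, hp, pderiv_mul, pderiv_X, map_add, smul_eq_mul, add_mul,
      Finset.sum_add_distrib, Finset.mul_sum]
    rw [add_comm]
    congr 1
    · exact Finset.sum_congr rfl fun i _ => by ring
    · rw [Finset.sum_eq_single j]
      · simp
      · intro i _ hi
        simp [Pi.single_eq_of_ne' hi]
      · simp

/-- The Zariski tangent space, with coefficients in `K`, at the `K`-valued point `φ` of the affine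
variety over `ℂ` having `φ` as a generic point: the vectors killed by the differentials at `φ` of
all polynomials that vanish at `φ`. -/
def tangentSpace {τ : Type} [Fintype τ] (φ : τ → K) : Submodule K (τ → K) where
  carrier := {v | ∀ f : MvPolynomial τ ℂ, aeval φ f = 0 → ∑ i, aeval φ (pderiv i f) * v i = 0}
  zero_mem' := by intro f _; simp
  add_mem' := by
    intro v w hv hw f hf
    simp [mul_add, Finset.sum_add_distrib, hv f hf, hw f hf]
  smul_mem' := by
    intro c v hv f hf
    have : ∑ i, aeval φ (pderiv i f) * (c • v) i = c * ∑ i, aeval φ (pderiv i f) * v i := by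
      rw [Finset.mul_sum]
      exact Finset.sum_congr rfl fun i _ => by simp; ring
    rw [this, hv f hf, mul_zero]

variable {τ : Type}

theorem Derivation.comp_mem_tangentSpace [Fintype τ] (D : Derivation ℂ K K) (φ : τ → K) :
    (fun i => D (φ i)) ∈ tangentSpace φ := by
  intro f hf
  rw [← D.map_mvPolynomial_aeval, hf, map_zero]

/-- Among the coordinates of `φ` there is a transcendence basis of the field they generate. -/
theorem exists_transcendence_coordinates (φ : τ → K) {I : Ideal (MvPolynomial τ ℂ)}
    (hI : ∀ p : MvPolynomial τ ℂ, aeval φ p = 0 ↔ p ∈ I) :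
    ∃ s : Set τ, AlgebraicIndependent ℂ (fun i : s => φ i) ∧
      (∀ j, IsAlgebraic (Algebra.adjoin ℂ (Set.range fun i : s => φ i)) (φ j)) ∧
      Cardinal.mk s = Algebra.trdeg ℂ (MvPolynomial τ ℂ ⧸ I) := by
  have hIp : I.IsPrime := by
    have : I = RingHom.ker (aeval φ : MvPolynomial τ ℂ →ₐ[ℂ] K) := by
      ext p; rw [← hI]; rfl
    rw [this]
    exact RingHom.ker_isPrime _
  let y : τ → MvPolynomial τ ℂ ⧸ I := fun j => Ideal.Quotient.mk I (X j)
  let e : (MvPolynomial τ ℂ ⧸ I) →ₐ[ℂ] K := Ideal.Quotient.liftₐ I (aeval φ)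
    fun p hp => (hI p).mpr hp
  have he : Function.Injective e := by
    rw [injective_iff_map_eq_zero]
    intro a ha
    obtain ⟨p, rfl⟩ := Ideal.Quotient.mk_surjective a
    exact Ideal.Quotient.eq_zero_iff_mem.mpr ((hI p).mp ha)
  have hey : ∀ j, e (y j) = φ j := fun j => aeval_X φ j
  have hadj : Algebra.adjoin ℂ (Set.range y) = ⊤ := by
    rw [Algebra.adjoin_range_eq_range_aeval, AlgHom.range_eq_top]
    have : aeval y = Ideal.Quotient.mkₐ ℂ I := by ext j; simp [y]
    rw [this]
    exact Ideal.Quotient.mkₐ_surjective ℂ I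
  have halg : Algebra.IsAlgebraic (Algebra.adjoin ℂ (Set.range y)) (MvPolynomial τ ℂ ⧸ I) :=
    ⟨fun a => isAlgebraic_algebraMap (⟨a, hadj ▸ trivial⟩ : Algebra.adjoin ℂ (Set.range y))⟩
  have hf := (faithfulSMul_iff_algebraMap_injective ℂ (MvPolynomial τ ℂ ⧸ I)).mpr
    (algebraMap ℂ (MvPolynomial τ ℂ ⧸ I)).injective
  obtain ⟨t, ht, htb⟩ := exists_isTranscendenceBasis_subset (R := ℂ) (Set.range y)
  have hsurj : Set.SurjOn y Set.univ t := fun a ha => by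
    obtain ⟨j, rfl⟩ := ht ha
    exact ⟨j, trivial, rfl⟩
  obtain ⟨s, -, hs⟩ := hsurj.exists_bijOn_subset
  let ε : s ≃ t := Set.BijOn.equiv y hs
  have hεy : (Subtype.val ∘ ε : s → _) = fun i : s => y i := rfl
  have hsb : IsTranscendenceBasis ℂ (fun i : s => y i) := by
    rw [← hεy]
    exact (isTranscendenceBasis_equiv ε).mpr htb
  have hφs : (e ∘ fun i : s => y i) = fun i : s => φ i := funext fun i => hey i
  have hind : AlgebraicIndependent ℂ (fun i : s => φ i) := by
    rw [← hφs]
    exact hsb.1.map' he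
  refine ⟨s, hind, fun j => ?_, ?_⟩
  · by_contra hcon
    have h1 := (hind.option_iff_transcendental (φ j)).mpr hcon
    have h2 : (fun o : Option s => o.elim (φ j) fun i => φ i) =
        e ∘ (fun o : Option s => o.elim (y j) fun i => y i) := by
      funext o
      cases o <;> simp [hey]
    rw [h2] at h1
    have h3 := AlgebraicIndependent.of_comp e h1
    have h4 := (hsb.1.option_iff_transcendental (y j)).mp h3
    exact h4 (hsb.isAlgebraic.isAlgebraic _)
  · rw [← htb.cardinalMk_eq_trdeg, Cardinal.mk_congr ε]

/-- A tangent vector is determined by its coordinates along a transcendence basis: it gives a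
derivation of the polynomial ring into `K` that factors through the coordinate ring, and that
vanishes on all elements algebraic over those coordinates. -/
theorem eq_zero_of_mem_tangentSpace [Fintype τ] {φ : τ → K} {s : Set τ}
    (hs : AlgebraicIndependent ℂ (fun i : s => φ i))
    (halg : ∀ j, IsAlgebraic (Algebra.adjoin ℂ (Set.range fun i : s => φ i)) (φ j))
    {v : τ → K} (hv : v ∈ tangentSpace φ) (h0 : ∀ i ∈ s, v i = 0) : v = 0 := by
  classical
  let R := MvPolynomial τ ℂ
  algebraize [(aeval (R := ℂ) φ).toRingHom]
  have htow : IsScalarTower ℂ R K := IsScalarTower.of_algebraMap_eq' (by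
    ext r; exact ((aeval (R := ℂ) φ).commutes r).symm)
  have hX : ∀ i, algebraMap R K (X i) = φ i := fun i => aeval_X _ i
  have hal : ∀ p : R, algebraMap R K p = aeval φ p := fun p => rfl
  let D : Derivation ℂ R K := mkDerivation ℂ v
  have hD : ∀ p : R, D p = ∑ i, aeval φ (pderiv i p) * v i := by
    intro p
    induction p using MvPolynomial.induction_on with
    | C a => rw [show D (C a) = 0 from D.map_algebraMap a]; simp
    | add p q hp hq => simp only [map_add, hp, hq, add_mul, Finset.sum_add_distrib]
    | mul_X p j hp =>
      rw [D.leibniz, hp, mkDerivation_X, Algebra.smul_def, Algebra.smul_def, hX, hal]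
      simp only [pderiv_mul, pderiv_X, map_add, map_mul, aeval_X, add_mul, Finset.sum_add_distrib,
        Finset.mul_sum]
      rw [add_comm]
      congr 1
      · exact Finset.sum_congr rfl fun i _ => by ring
      · rw [Finset.sum_eq_single j]
        · simp
        · intro i _ hi
          simp [Pi.single_eq_of_ne' hi]
        · simp
  let S : Subalgebra ℂ R := Algebra.adjoin ℂ (Set.range fun i : s => (X i : R))
  have hSr : ∀ p ∈ S, ∃ q : MvPolynomial s ℂ, p = aeval (fun i : s => (X (i : τ) : R)) q := by
    intro p hp
    simp only [S] at hp
    rw [Algebra.adjoin_range_eq_range_aeval] at hp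
    obtain ⟨q, rfl⟩ := hp
    exact ⟨q, rfl⟩
  have hcomp : ∀ q : MvPolynomial s ℂ, aeval φ (aeval (fun i : s => (X (i : τ) : R)) q) =
      aeval (fun i : s => φ i) q := by
    intro q
    rw [← AlgHom.comp_apply, comp_aeval]
    simp
  funext j
  have key : D (X j) = 0 := by
    refine Derivation.eq_zero_of_isAlgebraic D (fun r hr => ?_) S (fun p hp => ?_)
      (fun p hp h => ?_) ?_
    · rw [hD]
      exact hv r hr
    · have : Set.EqOn D (0 : Derivation ℂ R K) (Set.range fun i : s => (X (i : τ) : R)) := by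
        rintro _ ⟨i, rfl⟩
        change D (X (i : τ)) = 0
        rw [mkDerivation_X]
        exact h0 i i.2
      exact Derivation.eqOn_adjoin this hp
    · obtain ⟨q, rfl⟩ := hSr p hp
      rw [hal, hcomp] at h
      rw [(algebraicIndependent_iff.mp hs) q h, map_zero]
    · have hmem : ∀ p : S, aeval φ (p : R) ∈
          Algebra.adjoin ℂ (Set.range fun i : s => φ i) := by
        intro p
        obtain ⟨q, hq⟩ := hSr p p.2
        rw [hq, hcomp, Algebra.adjoin_range_eq_range_aeval]
        exact ⟨q, rfl⟩
      let g : S →+* Algebra.adjoin ℂ (Set.range fun i : s => φ i) :=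
        RingHom.codRestrict ((aeval φ : R →ₐ[ℂ] K).toRingHom.comp S.val.toRingHom) _ hmem
      refine IsAlgebraic.of_ringHom_of_comp_eq (S := Algebra.adjoin ℂ (Set.range fun i : s => φ i))
        (B := K) g (RingHom.id K) ?_ ?_ Function.injective_id ?_
      · rw [RingHom.id_apply, hX]
        exact halg j
      · rintro ⟨a, ha⟩
        have ha' := ha
        rw [Algebra.adjoin_range_eq_range_aeval] at ha'
        obtain ⟨q, hq⟩ := ha'
        have hqS : aeval (fun i : s => (X (i : τ) : R)) q ∈ S := by
          simp only [S]
          rw [Algebra.adjoin_range_eq_range_aeval]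
          exact ⟨q, rfl⟩
        exact ⟨⟨_, hqS⟩, Subtype.ext ((hcomp q).trans hq)⟩
      · ext p
        rfl
  rw [mkDerivation_X] at key
  exact key

/-- Tangent vectors at `φ` are the values of derivations at `φ`. -/
theorem mem_tangentSpace_iff_exists_derivation [Fintype τ] {φ : τ → K} {v : τ → K} :
    v ∈ tangentSpace φ ↔ ∃ D : Derivation ℂ K K, ∀ i, D (φ i) = v i := by
  constructor
  · intro hv
    obtain ⟨s, hs, halg, -⟩ := exists_transcendence_coordinates φ
      (I := RingHom.ker (aeval φ : MvPolynomial τ ℂ →ₐ[ℂ] K)) fun p => Iff.rfl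
    obtain ⟨D, hD⟩ := hs.exists_derivation fun i => v i
    have h1 : v - (fun i => D (φ i)) = 0 := by
      refine eq_zero_of_mem_tangentSpace hs halg
        (Submodule.sub_mem _ hv (D.comp_mem_tangentSpace φ)) fun i hi => ?_
      simpa [sub_eq_zero] using (hD ⟨i, hi⟩).symm
    exact ⟨D, fun i => (congrFun (sub_eq_zero.mp h1) i).symm⟩
  · rintro ⟨D, hD⟩
    have := D.comp_mem_tangentSpace φ
    rwa [funext hD] at this

/-- The tangent space at a generic point has the dimension of the variety. -/
theorem finrank_tangentSpace [Fintype τ] (φ : τ → K) {I : Ideal (MvPolynomial τ ℂ)}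
    (hI : ∀ p : MvPolynomial τ ℂ, aeval φ p = 0 ↔ p ∈ I) {d : ℕ}
    (hd : Algebra.trdeg ℂ (MvPolynomial τ ℂ ⧸ I) = d) : Module.finrank K (tangentSpace φ) = d := by
  classical
  obtain ⟨s, hs, halg, hcard⟩ := exists_transcendence_coordinates φ hI
  let ρ : tangentSpace φ →ₗ[K] (s → K) := (LinearMap.funLeft K K (Subtype.val : s → τ)).comp
    (tangentSpace φ).subtype
  have hinj : Function.Injective ρ := by
    rw [injective_iff_map_eq_zero]
    intro v hv
    exact Subtype.ext (eq_zero_of_mem_tangentSpace hs halg v.2 fun i hi => congrFun hv ⟨i, hi⟩)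
  have hsurj : Function.Surjective ρ := by
    intro u
    obtain ⟨D, hD⟩ := hs.exists_derivation u
    exact ⟨⟨_, D.comp_mem_tangentSpace φ⟩, funext fun i => hD i⟩
  rw [(LinearEquiv.ofBijective ρ ⟨hinj, hsurj⟩).finrank_eq, Module.finrank_fintype_fun_eq_card]
  rw [hd, Cardinal.mk_fintype] at hcard
  exact_mod_cast hcard

/-- An element killed by all derivations over `ℂ` is a constant. -/
theorem exists_algebraMap_eq_of_derivation_eq_zero {a : K} (ha : ∀ D : Derivation ℂ K K, D a = 0) :
    ∃ c : ℂ, algebraMap ℂ K c = a := by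
  have halg : IsAlgebraic ℂ a := by
    by_contra hcon
    have hind : AlgebraicIndependent ℂ (fun _ : Unit => a) :=
      algebraicIndependent_unique_type_iff.mpr hcon
    obtain ⟨D, hD⟩ := hind.exists_derivation fun _ => 1
    exact one_ne_zero ((hD ()).symm.trans (ha D))
  exact minpoly.mem_range_of_degree_eq_one ℂ a
    (IsAlgClosed.degree_eq_one_of_irreducible ℂ (minpoly.irreducible halg.isIntegral))

end Derivations

/-! ### Generic tuples of points of a variety -/

section Generic

variable {K : Type} [Field K] [Algebra ℂ K] {ι σ : Type}

/-- A tuple `x` of `K`-valued points is generic for the cone `C` if the polynomial relations over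
`ℂ` between its coordinates are exactly those that hold for all tuples of points of `C`. -/
def IsGeneric (C : Set (σ → ℂ)) (x : ι → σ → K) : Prop :=
  ∀ g : MvPolynomial (ι × σ) ℂ, aeval (Function.uncurry x) g = 0 ↔
    ∀ a : ι → σ → ℂ, (∀ k, a k ∈ C) → aeval (Function.uncurry a) g = 0

/-- Substitution of the coordinates of the points `a l`, for `l ≠ k`, into a polynomial in the
coordinates of a tuple of points. -/
noncomputable def substCoord [DecidableEq ι] (a : ι → σ → ℂ) (k : ι) :
    MvPolynomial (ι × σ) ℂ →ₐ[ℂ] MvPolynomial σ ℂ :=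
  aeval fun p => if p.1 = k then X p.2 else C (a p.1 p.2)

theorem aeval_substCoord [DecidableEq ι] (a : ι → σ → ℂ) (k : ι) (c : σ → ℂ)
    (g : MvPolynomial (ι × σ) ℂ) :
    aeval c (substCoord a k g) = aeval (Function.uncurry (Function.update a k c)) g := by
  rw [substCoord, ← AlgHom.comp_apply, comp_aeval]
  congr 2
  funext p
  by_cases h : p.1 = k
  · simp [h, Function.uncurry]
  · simp [h, Function.uncurry, Function.update_of_ne]

/-- Products of irreducible varieties over `ℂ` are irreducible: points where two polynomials do not
vanish are moved to a common point, one factor at a time. -/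
theorem exists_aeval_ne_zero_and_ne_zero [Finite ι] {C : Set (σ → ℂ)}
    (hC : (vanishingIdeal ℂ C).IsPrime) {f g : MvPolynomial (ι × σ) ℂ} {a b : ι → σ → ℂ}
    (ha : ∀ k, a k ∈ C) (hb : ∀ k, b k ∈ C) (hf : aeval (Function.uncurry a) f ≠ 0)
    (hg : aeval (Function.uncurry b) g ≠ 0) :
    ∃ c : ι → σ → ℂ, (∀ k, c k ∈ C) ∧ aeval (Function.uncurry c) f ≠ 0 ∧
      aeval (Function.uncurry c) g ≠ 0 := by
  classical
  have := Fintype.ofFinite ι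
  suffices h : ∀ A : Finset ι, ∃ a b : ι → σ → ℂ, (∀ k, a k ∈ C) ∧ (∀ k, b k ∈ C) ∧
      aeval (Function.uncurry a) f ≠ 0 ∧ aeval (Function.uncurry b) g ≠ 0 ∧ ∀ k ∈ A, a k = b k by
    obtain ⟨a, b, ha, -, hf, hg, hab⟩ := h Finset.univ
    obtain rfl : a = b := funext fun k => hab k (Finset.mem_univ k)
    exact ⟨a, ha, hf, hg⟩
  intro A
  induction A using Finset.induction_on with
  | empty => exact ⟨a, b, ha, hb, hf, hg, by simp⟩
  | insert k A _ ih =>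
    obtain ⟨a, b, ha, hb, hf, hg, hab⟩ := ih
    have hf' : substCoord a k f ∉ vanishingIdeal ℂ C := fun h => hf <| by
      have := h (a k) (ha k)
      rwa [aeval_substCoord, Function.update_eq_self] at this
    have hg' : substCoord b k g ∉ vanishingIdeal ℂ C := fun h => hg <| by
      have := h (b k) (hb k)
      rwa [aeval_substCoord, Function.update_eq_self] at this
    have hfg : substCoord a k f * substCoord b k g ∉ vanishingIdeal ℂ C :=
      fun h => (hC.mem_or_mem h).elim hf' hg'
    rw [mem_vanishingIdeal_iff] at hfg
    push Not at hfg
    obtain ⟨c, hc, hne⟩ := hfg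
    rw [map_mul, aeval_substCoord, aeval_substCoord] at hne
    have hmem : ∀ d : ι → σ → ℂ, (∀ k, d k ∈ C) → ∀ l, Function.update d k c l ∈ C := by
      intro d hd l
      by_cases h : l = k
      · subst h; simpa using hc
      · simpa [Function.update_of_ne h] using hd l
    refine ⟨Function.update a k c, Function.update b k c, hmem a ha, hmem b hb,
      left_ne_zero_of_mul hne, right_ne_zero_of_mul hne, fun l hl => ?_⟩
    by_cases h : l = k
    · subst h; simp
    · simpa [Function.update_of_ne h] using hab l ((Finset.mem_insert.mp hl).resolve_left h)

/-- Over a suitable extension field, an irreducible variety has generic tuples of points. -/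
theorem exists_isGeneric [Finite ι] {C : Set (σ → ℂ)}
    (hC : (vanishingIdeal ℂ C).IsPrime) :
    ∃ (K : Type) (_ : Field K) (_ : Algebra ℂ K) (x : ι → σ → K), IsGeneric C x := by
  let P : Ideal (MvPolynomial (ι × σ) ℂ) :=
    vanishingIdeal ℂ (Function.uncurry '' {a : ι → σ → ℂ | ∀ k, a k ∈ C})
  have hP : ∀ g, g ∈ P ↔ ∀ a : ι → σ → ℂ, (∀ k, a k ∈ C) → aeval (Function.uncurry a) g = 0 :=
    fun g => Set.forall_mem_image
  have hne : C.Nonempty := by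
    by_contra h
    rw [Set.not_nonempty_iff_eq_empty] at h
    refine hC.ne_top ?_
    rw [h]
    exact vanishingIdeal_empty
  have hprime : P.IsPrime := by
    refine ⟨fun h => ?_, fun {f g} hfg => ?_⟩
    · obtain ⟨c, hc⟩ := hne
      have h1 := (hP 1).mp (h ▸ trivial) (fun _ => c) (fun _ => hc)
      simp at h1
    · by_contra! hcon
      rw [hP, hP] at hcon
      push Not at hcon
      obtain ⟨⟨a, ha, hfa⟩, b, hb, hgb⟩ := hcon
      obtain ⟨c, hc, hfc, hgc⟩ := exists_aeval_ne_zero_and_ne_zero hC ha hb hfa hgb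
      have := (hP _).mp hfg c hc
      rw [map_mul] at this
      exact mul_ne_zero hfc hgc this
  obtain ⟨F, i1, i2, x, hx⟩ := exists_generic_point P
  exact ⟨F, i1, i2, Function.curry x, fun g => (hx g).trans (hP g)⟩

theorem aeval_rename_uncurry {R : Type} [CommRing R] [Algebra ℂ R] (x : ι → σ → R) (k : ι)
    (p : MvPolynomial σ ℂ) :
    aeval (Function.uncurry x) (rename (Prod.mk k) p) = aeval (x k) p := by
  rw [aeval_rename]
  rfl

theorem aeval_uncurry_aeval_add {R : Type} [CommRing R] [Algebra ℂ R] (x : ι → σ → R) (i j : ι)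
    (p : MvPolynomial σ ℂ) :
    aeval (Function.uncurry x) (aeval (fun s => (X (i, s) + X (j, s) : MvPolynomial (ι × σ) ℂ)) p) =
      aeval (x i + x j) p := by
  rw [← AlgHom.comp_apply, comp_aeval]
  congr 2
  funext s
  simp [Function.uncurry]

namespace IsGeneric

variable {C : Set (σ → ℂ)} {x : ι → σ → K}

theorem nonempty (hx : IsGeneric C x) : ∃ a : ι → σ → ℂ, ∀ k, a k ∈ C := by
  by_contra! h
  have := (hx 1).mpr fun a ha => absurd ha (by simpa using h a)
  simp at this

/-- Each member of a generic tuple is a generic point. -/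
theorem aeval_eq_zero_iff (hx : IsGeneric C x) (k : ι) (p : MvPolynomial σ ℂ) :
    aeval (x k) p = 0 ↔ p ∈ vanishingIdeal ℂ C := by
  classical
  rw [← aeval_rename_uncurry, hx]
  constructor
  · intro h c hc
    obtain ⟨a, ha⟩ := hx.nonempty
    have := h (fun _ => c) fun _ => hc
    rwa [aeval_rename_uncurry] at this
  · intro h a ha
    rw [aeval_rename_uncurry]
    exact h _ (ha k)

/-- Coordinates that are independent for each member of a generic tuple are independent
altogether. -/
theorem algebraicIndependent [Finite ι] (hx : IsGeneric C x) (s : ι → Set σ)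
    (hs : ∀ k, AlgebraicIndependent ℂ fun i : s k => x k i) :
    AlgebraicIndependent ℂ fun p : {p : ι × σ | p.2 ∈ s p.1} => x p.1.1 p.1.2 := by
  classical
  have := Fintype.ofFinite ι
  set S : Set (ι × σ) := {p : ι × σ | p.2 ∈ s p.1} with hS
  rw [algebraicIndependent_iff]
  intro q hq
  set g : MvPolynomial (ι × σ) ℂ := rename Subtype.val q with hg
  have hgS : g ∈ supported ℂ S := by
    rw [supported_eq_range_rename]
    exact ⟨q, rfl⟩
  have h0 : aeval (Function.uncurry x) g = 0 := by
    rw [hg, aeval_rename]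
    exact hq
  have hind : ∀ k, ∀ p ∈ supported ℂ (s k), aeval (x k) p = 0 → p = 0 := by
    intro k p hp h
    rw [supported_eq_range_rename] at hp
    obtain ⟨q, rfl⟩ := hp
    change aeval (x k) (rename Subtype.val q) = 0 at h
    rw [aeval_rename] at h
    rw [algebraicIndependent_iff.mp (hs k) q h, map_zero]
  have hsub : ∀ (a : ι → σ → ℂ) (k : ι), substCoord a k g ∈ supported ℂ (s k) := by
    intro a k
    have hle : supported ℂ S ≤ (supported ℂ (s k)).comap (substCoord a k) := by
      refine Algebra.adjoin_le ?_
      rintro _ ⟨⟨l, i⟩, hp, rfl⟩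
      change substCoord a k (X (l, i)) ∈ supported ℂ (s k)
      rw [substCoord, aeval_X]
      by_cases h : l = k
      · subst h
        simp only [if_true]
        exact (X_mem_supported).mpr hp
      · simp only [h, if_false]
        exact (supported ℂ (s k)).algebraMap_mem _
    exact hle hgS
  have key : ∀ A : Finset ι, ∀ a : ι → σ → ℂ, (∀ k ∉ A, a k ∈ C) →
      aeval (Function.uncurry a) g = 0 := by
    intro A
    induction A using Finset.induction_on with
    | empty => exact fun a ha => (hx g).mp h0 a fun k => ha k (by simp)
    | insert k A hk ih =>
      intro a ha
      have h1 : substCoord a k g = 0 := by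
        refine hind k _ (hsub a k) ((hx.aeval_eq_zero_iff k _).mpr fun c hc => ?_)
        rw [aeval_substCoord]
        refine ih _ fun l hl => ?_
        by_cases h : l = k
        · subst h; simpa using hc
        · rw [Function.update_of_ne h]
          exact ha l (by simp [h, hl])
      have h2 := aeval_substCoord a k (a k) g
      rw [h1, map_zero, Function.update_eq_self] at h2
      exact h2.symm
  have hg0 : g = 0 := by
    refine MvPolynomial.funext fun a => ?_
    have := key Finset.univ (Function.curry a) (by simp)
    rw [Function.uncurry_curry, aeval_eq_eval] at this
    rw [map_zero]
    exact this
  exact rename_injective _ Subtype.val_injective (hg0.trans (map_zero _).symm)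

/-- Derivations can be prescribed independently on the members of a generic tuple. -/
theorem exists_derivation [Finite ι] [Fintype σ] (hx : IsGeneric C x) {u : ι → σ → K}
    (hu : ∀ k, u k ∈ tangentSpace (x k)) : ∃ D : Derivation ℂ K K, ∀ k i, D (x k i) = u k i := by
  choose s hs halg _ using fun k => exists_transcendence_coordinates (x k) (hx.aeval_eq_zero_iff k)
  obtain ⟨D, hD⟩ := (hx.algebraicIndependent s hs).exists_derivation fun p => u p.1.1 p.1.2
  refine ⟨D, fun k => ?_⟩
  have h1 : (fun i => D (x k i)) - u k = 0 := by
    refine eq_zero_of_mem_tangentSpace (hs k) (halg k)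
      (Submodule.sub_mem _ (D.comp_mem_tangentSpace (x k)) (hu k)) fun i hi => ?_
    simpa [sub_eq_zero] using hD ⟨(k, i), hi⟩
  exact fun i => congrFun (sub_eq_zero.mp h1) i

/-- Terracini's lemma: the tangent space of the secant variety at `x i + x j` is spanned by the
tangent spaces at `x i` and `x j`. -/
theorem tangentSpace_add [Finite ι] [Fintype σ] (hx : IsGeneric C x) {i j : ι} (hij : i ≠ j) :
    tangentSpace (x i + x j) = tangentSpace (x i) ⊔ tangentSpace (x j) := by
  classical
  refine le_antisymm (fun v hv => ?_) (sup_le (fun v hv => ?_) fun v hv => ?_)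
  · obtain ⟨D, hD⟩ := mem_tangentSpace_iff_exists_derivation.mp hv
    refine Submodule.mem_sup.mpr ⟨_, D.comp_mem_tangentSpace (x i), _,
      D.comp_mem_tangentSpace (x j),
      funext fun s => ?_⟩
    rw [← hD s]
    simp
  · obtain ⟨D, hD⟩ := hx.exists_derivation (u := Pi.single i v) fun k => by
      by_cases h : k = i
      · subst h; simpa using hv
      · rw [Pi.single_eq_of_ne h]; exact Submodule.zero_mem _
    refine mem_tangentSpace_iff_exists_derivation.mpr ⟨D, fun s => ?_⟩
    simp [hD, Pi.single_eq_of_ne' hij]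
  · obtain ⟨D, hD⟩ := hx.exists_derivation (u := Pi.single j v) fun k => by
      by_cases h : k = j
      · subst h; simpa using hv
      · rw [Pi.single_eq_of_ne h]; exact Submodule.zero_mem _
    refine mem_tangentSpace_iff_exists_derivation.mpr ⟨D, fun s => ?_⟩
    simp [hD, Pi.single_eq_of_ne hij]

/-- Euler's relation: a cone is tangent to its rulings. -/
theorem mem_tangentSpace [Fintype σ] (hC : ∀ v ∈ C, ∀ c : ℂ, c • v ∈ C) (hx : IsGeneric C x)
    (k : ι) : x k ∈ tangentSpace (x k) := by
  intro f hf
  have hhom : ∀ d, aeval (x k) (homogeneousComponent d f) = 0 := fun d =>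
    (hx.aeval_eq_zero_iff k _).mpr
      (homogeneousComponent_mem_vanishingIdeal hC ((hx.aeval_eq_zero_iff k f).mp hf) d)
  have hE : ∀ d, ∑ i, aeval (x k) (pderiv i (homogeneousComponent d f)) * x k i = 0 := by
    intro d
    have h1 := congrArg (aeval (x k)) (homogeneousComponent_isHomogeneous d f).sum_X_mul_pderiv
    rw [map_nsmul, hhom, smul_zero, map_sum] at h1
    rw [← h1]
    exact Finset.sum_congr rfl fun i _ => by rw [map_mul, aeval_X, mul_comm]
  conv_lhs => rw [← sum_homogeneousComponent f]
  simp only [map_sum, Finset.sum_mul]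
  rw [Finset.sum_comm]
  exact Finset.sum_eq_zero fun d _ => hE d

end IsGeneric

theorem totalDegree_pderiv_lt {f : MvPolynomial σ ℂ} {i : σ} (h : pderiv i f ≠ 0) :
    (pderiv i f).totalDegree < f.totalDegree := by
  classical
  obtain ⟨m, hm, hdeg⟩ := Finset.exists_mem_eq_sup _ (support_nonempty.mpr h)
    fun s : σ →₀ ℕ => s.sum fun _ e => e
  change (pderiv i f).totalDegree = _ at hdeg
  have h1 : m + Finsupp.single i 1 ∈ f.support := by
    rw [mem_support_iff] at hm ⊢
    rw [coeff_pderiv] at hm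
    exact left_ne_zero_of_mul hm
  have h2 := le_totalDegree h1
  rw [Finsupp.sum_add_index' (by simp) (by simp), Finsupp.sum_single_index rfl] at h2
  omega

theorem eq_C_of_pderiv_eq_zero {f : MvPolynomial σ ℂ} (h : ∀ i, pderiv i f = 0) :
    f = C (coeff 0 f) := by
  classical
  ext m
  rw [coeff_C]
  split_ifs with hm
  · rw [hm]
  · obtain ⟨i, hi⟩ : ∃ i, m i ≠ 0 := by
      by_contra! hcon
      exact hm (Finsupp.ext fun i => (hcon i).symm)
    have h1 := congrArg (coeff (m - Finsupp.single i 1)) (h i)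
    rw [coeff_pderiv, tsub_add_cancel_of_le (by simpa using Nat.one_le_iff_ne_zero.mpr hi),
      coeff_zero] at h1
    exact (mul_eq_zero.mp h1).resolve_right (Nat.cast_add_one_ne_zero _)

/-- A nonzero polynomial of least degree vanishing at `φ` has a nonzero differential at `φ`. -/
theorem exists_aeval_pderiv_ne_zero {φ : σ → K}
    (h : ∃ f : MvPolynomial σ ℂ, f ≠ 0 ∧ aeval φ f = 0) :
    ∃ f : MvPolynomial σ ℂ, aeval φ f = 0 ∧ ∃ i, aeval φ (pderiv i f) ≠ 0 := by
  classical
  have hex : ∃ n, ∃ f : MvPolynomial σ ℂ, f ≠ 0 ∧ aeval φ f = 0 ∧ f.totalDegree = n := by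
    obtain ⟨f, hf, hf0⟩ := h
    exact ⟨_, f, hf, hf0, rfl⟩
  obtain ⟨f, hf, hf0, hdeg⟩ := Nat.find_spec hex
  refine ⟨f, hf0, ?_⟩
  by_contra! hcon
  have hz : ∀ i, pderiv i f = 0 := fun i => by
    by_contra hne
    refine Nat.find_min hex (m := (pderiv i f).totalDegree) ?_ ⟨_, hne, hcon i, rfl⟩
    rw [← hdeg]
    exact totalDegree_pderiv_lt hne
  have hc := eq_C_of_pderiv_eq_zero hz
  rw [hc, aeval_C] at hf0
  have h0 : coeff 0 f = 0 := (map_eq_zero _).mp hf0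
  rw [h0, C_0] at hc
  exact hf hc

/-- If two generic points of a nondegenerate cone have a secant variety that does not fill the
space, then the tangent space of that secant variety does not contain a third generic point. -/
theorem IsGeneric.notMem_sup [Finite ι] [Fintype σ] {C : Set (σ → ℂ)} {x : ι → σ → K}
    (hx : IsGeneric C x)
    (hnd : ∀ l : σ → ℂ, (∀ a ∈ C, ∑ s, l s * a s = 0) → l = 0)
    {i j k : ι} (hij : i ≠ j) (hik : i ≠ k) (hjk : j ≠ k)
    (h : ∃ f : MvPolynomial σ ℂ, f ≠ 0 ∧ aeval (x i + x j) f = 0) :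
    x k ∉ tangentSpace (x i) ⊔ tangentSpace (x j) := by
  classical
  rw [← hx.tangentSpace_add hij]
  intro hmem
  obtain ⟨f, hf0, t, ht⟩ := exists_aeval_pderiv_ne_zero h
  let g : MvPolynomial (ι × σ) ℂ :=
    ∑ s, aeval (fun s => (X (i, s) + X (j, s) : MvPolynomial (ι × σ) ℂ)) (pderiv s f) * X (k, s)
  have hgR : ∀ {R : Type} [CommRing R] [Algebra ℂ R] (y : ι → σ → R),
      aeval (Function.uncurry y) g = ∑ s, aeval (y i + y j) (pderiv s f) * y k s := by
    intro R _ _ y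
    simp only [g, map_sum, map_mul, aeval_uncurry_aeval_add, aeval_X]
    rfl
  have hg0 : aeval (Function.uncurry x) g = 0 := by
    rw [hgR]
    exact hmem f hf0
  have hg := (hx g).mp hg0
  obtain ⟨a, ha, hne⟩ : ∃ a : ι → σ → ℂ, (∀ k, a k ∈ C) ∧ aeval (a i + a j) (pderiv t f) ≠ 0 := by
    by_contra! hcon
    refine ht ?_
    rw [← aeval_uncurry_aeval_add]
    refine (hx _).mpr fun a ha => ?_
    rw [aeval_uncurry_aeval_add]
    exact hcon a ha
  refine hne (congrFun (hnd (fun s => aeval (a i + a j) (pderiv s f)) fun c hc => ?_) t)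
  have h1 := hg (Function.update a k c) fun l => by
    by_cases hl : l = k
    · subst hl; simpa using hc
    · rw [Function.update_of_ne hl]; exact ha l
  rw [hgR] at h1
  simpa [Function.update_of_ne hik, Function.update_of_ne hjk] using h1

end Generic

/-! ### The vertex -/

section Wedge

/-- The exterior product of two vectors, in Plücker coordinates. -/
def wedge {σ R : Type} [Preorder σ] [CommRing R] (a b : σ → R) : (Fin 2 ↪o σ) → R :=
  fun s => a (s 0) * b (s 1) - a (s 1) * b (s 0)

variable {σ R : Type} [LinearOrder σ] [CommRing R]

theorem exists_orderEmbedding_apply {s t : σ} (h : s < t) : ∃ e : Fin 2 ↪o σ, e 0 = s ∧ e 1 = t :=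
  ⟨OrderEmbedding.ofStrictMono ![s, t] (by
    intro i j hij
    fin_cases i <;> fin_cases j <;> simp_all), rfl, rfl⟩

theorem eq_zero_of_wedge_add_wedge {a b c d : σ → R} (h : wedge a b + wedge c d = 0) (s t : σ) :
    a s * b t - a t * b s + (c s * d t - c t * d s) = 0 := by
  rcases lt_trichotomy s t with hst | rfl | hst
  · obtain ⟨e, rfl, rfl⟩ := exists_orderEmbedding_apply hst
    exact congrFun h e
  · ring
  · obtain ⟨e, rfl, rfl⟩ := exists_orderEmbedding_apply hst
    have := congrFun h e
    simp only [wedge, Pi.add_apply, Pi.zero_apply] at this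
    linear_combination -this

/-- If `p ∧ b + a ∧ q = 0` with `a`, `b` linearly independent, then `p` and `q` are combinations of
`a` and `b`: wedging with `b` and with `a` gives `a ∧ q ∧ b = 0` and `p ∧ b ∧ a = 0`. -/
theorem exists_eq_of_wedge_add_wedge_eq_zero {K : Type} [Field K] {a b p q : σ → K}
    (h : wedge p b + wedge a q = 0) {s t : σ} (hΔ : a s * b t - a t * b s ≠ 0) :
    ∃ α β γ : K, p = α • a + β • b ∧ q = γ • a + (-α) • b := by
  have hE := eq_zero_of_wedge_add_wedge h
  set Δ := a s * b t - a t * b s with hΔd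
  refine ⟨(p s * b t - p t * b s) / Δ, (a s * p t - a t * p s) / Δ,
    (q s * b t - q t * b s) / Δ, funext fun u => ?_, funext fun u => ?_⟩
  · simp only [Pi.add_apply, Pi.smul_apply, smul_eq_mul]
    field_simp
    rw [hΔd]
    linear_combination -a u * hE s t - a s * hE t u - a t * hE u s
  · simp only [Pi.add_apply, Pi.smul_apply, smul_eq_mul]
    field_simp
    rw [hΔd]
    linear_combination -b u * hE s t - b s * hE t u - b t * hE u s + b u * hE s t

end Wedge

section Vertex

variable {K : Type} [Field K] [Algebra ℂ K] {σ : Type} [Fintype σ]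

/-- A derivation killing the coordinates of `φ` maps the tangent space at `φ` to itself. -/
theorem Derivation.map_mem_tangentSpace {φ v : σ → K} (hv : v ∈ tangentSpace φ)
    (D : Derivation ℂ K K) (hD : ∀ i, D (φ i) = 0) : (fun i => D (v i)) ∈ tangentSpace φ := by
  intro f hf
  have h1 := congrArg D (hv f hf)
  have h2 : ∀ g : MvPolynomial σ ℂ, D (aeval φ g) = 0 := fun g => by
    rw [D.map_mvPolynomial_aeval]
    simp [hD]
  rw [map_sum, map_zero] at h1
  rw [← h1]
  refine Finset.sum_congr rfl fun i _ => ?_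
  rw [D.leibniz, h2]
  simp

/-- If two tangent spaces meet in a line, a derivation killing both base points kills the
normalised generator of this line. -/
theorem Derivation.apply_eq_zero_of_inf {φ ψ p : σ → K} (hp : p ∈ tangentSpace φ ⊓ tangentSpace ψ)
    (hinf : Module.finrank K (tangentSpace φ ⊓ tangentSpace ψ : Submodule K (σ → K)) = 1)
    {j : σ} (hj : p j = 1) (D : Derivation ℂ K K) (hφ : ∀ i, D (φ i) = 0) (hψ : ∀ i, D (ψ i) = 0)
    (s : σ) : D (p s) = 0 := by
  have hp0 : (⟨p, hp⟩ : (tangentSpace φ ⊓ tangentSpace ψ : Submodule K (σ → K))) ≠ 0 := by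
    intro h
    have h1 := congrFun (congrArg Subtype.val h) j
    change p j = 0 at h1
    rw [hj] at h1
    exact one_ne_zero h1
  obtain ⟨c, hc⟩ := (finrank_eq_one_iff_of_nonzero' _ hp0).mp hinf
    ⟨fun i => D (p i), D.map_mem_tangentSpace hp.1 hφ, D.map_mem_tangentSpace hp.2 hψ⟩
  have hc' : ∀ i, c * p i = D (p i) := fun i => congrFun (congrArg Subtype.val hc) i
  have h0 := hc' j
  rw [hj, D.map_one_eq_zero, mul_one] at h0
  rw [← hc' s, h0, zero_mul]

variable {C : Set (σ → ℂ)} {x : Fin 3 → σ → K}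

/-- A line common to the tangent spaces at three generic points, any two of which meet in this line
only, is defined over `ℂ`: every derivation is a sum of derivations moving at most one of the three
points. -/
theorem IsGeneric.exists_constant_of_mem_inf (hx : IsGeneric C x) {p : σ → K}
    (hp : ∀ k, p ∈ tangentSpace (x k)) {j : σ} (hj : p j = 1)
    (hinf : ∀ i j, i ≠ j → Module.finrank K
      (tangentSpace (x i) ⊓ tangentSpace (x j) : Submodule K (σ → K)) = 1) :
    ∃ v : σ → ℂ, ∀ s, algebraMap ℂ K (v s) = p s := by
  classical
  have hkill : ∀ (D : Derivation ℂ K K) (i k : Fin 3), i ≠ k → (∀ s, D (x i s) = 0) →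
      (∀ s, D (x k s) = 0) → ∀ s, D (p s) = 0 := fun D i k hik hi hk =>
    D.apply_eq_zero_of_inf ⟨hp i, hp k⟩ (hinf i k hik) hj hi hk
  have hall : ∀ (D : Derivation ℂ K K) s, D (p s) = 0 := by
    intro D s
    have hE : ∀ k, ∃ E : Derivation ℂ K K, ∀ l s, E (x l s) = if l = k then D (x k s) else 0 := by
      intro k
      refine hx.exists_derivation (u := fun l s => if l = k then D (x k s) else 0) fun l => ?_
      by_cases h : l = k
      · subst h; simpa using D.comp_mem_tangentSpace (x l)
      · simp only [h, if_false]; exact Submodule.zero_mem _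
    choose E hE using hE
    have h0 := hkill (E 0) 1 2 (by decide) (by simp [hE]) (by simp [hE]) s
    have h1 := hkill (E 1) 0 2 (by decide) (by simp [hE]) (by simp [hE]) s
    have h2 := hkill (E 2) 0 1 (by decide) (by simp [hE]) (by simp [hE]) s
    have h3 := hkill (D - E 0 - E 1 - E 2) 0 1 (by decide) (by simp [hE]) (by simp [hE]) s
    simpa [h0, h1, h2] using h3
  choose v hv using fun s => exists_algebraMap_eq_of_derivation_eq_zero fun D => hall D s
  exact ⟨v, hv⟩

/-- The join of the lines through `x 0`, `x 2` and `x 1`, `x 2` moves in a family of dimension less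
than three times that of the cone only if the three tangent spaces have a common vector. -/
theorem IsGeneric.exists_mem_tangentSpace [LinearOrder σ] (hx : IsGeneric C x)
    (hcone : ∀ v ∈ C, ∀ c : ℂ, c • v ∈ C) {d : ℕ}
    (hrank : ∀ k, Module.finrank K (tangentSpace (x k)) = d)
    (hmem : ∀ i j k, i ≠ j → i ≠ k → j ≠ k → x k ∉ tangentSpace (x i) ⊔ tangentSpace (x j))
    {s t : σ} (hΔ : (x 0 s + x 2 s) * (x 1 t + x 2 t) - (x 0 t + x 2 t) * (x 1 s + x 2 s) ≠ 0)
    (hw : Module.finrank K (tangentSpace (wedge (x 0 + x 2) (x 1 + x 2))) < 3 * d) :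
    ∃ p : σ → K, p ≠ 0 ∧ ∀ k, p ∈ tangentSpace (x k) := by
  classical
  let Φ : (tangentSpace (x 0) × tangentSpace (x 1) × tangentSpace (x 2)) →ₗ[K]
      ((Fin 2 ↪o σ) → K) :=
    { toFun := fun u => wedge (u.1.1 + u.2.2.1) (x 1 + x 2) + wedge (x 0 + x 2) (u.2.1.1 + u.2.2.1)
      map_add' := fun u v => funext fun e => by
        simp only [wedge, Pi.add_apply, Prod.fst_add, Prod.snd_add, Submodule.coe_add]
        ring
      map_smul' := fun c u => funext fun e => by
        simp only [wedge, Pi.add_apply, Prod.smul_fst, Prod.smul_snd, Submodule.coe_smul,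
          Pi.smul_apply, smul_eq_mul, RingHom.id_apply]
        ring }
  have hΦ : ∀ u, Φ u ∈ tangentSpace (wedge (x 0 + x 2) (x 1 + x 2)) := by
    rintro ⟨⟨u0, h0⟩, ⟨u1, h1⟩, ⟨u2, h2⟩⟩
    obtain ⟨D, hD⟩ := hx.exists_derivation (u := ![u0, u1, u2]) fun k => by
      fin_cases k
      exacts [h0, h1, h2]
    refine mem_tangentSpace_iff_exists_derivation.mpr ⟨D, fun e => ?_⟩
    have d0 := hD 0
    have d1 := hD 1
    have d2 := hD 2
    simp only [Matrix.cons_val] at d0 d1 d2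
    simp only [wedge, Pi.add_apply, map_sub, D.leibniz, map_add, d0, d1, d2, smul_eq_mul, Φ,
      LinearMap.coe_mk, AddHom.coe_mk]
    ring
  have hker : (Φ.codRestrict _ hΦ).ker ≠ ⊥ := by
    refine LinearMap.ker_ne_bot_of_finrank_lt ?_
    rw [Module.finrank_prod, Module.finrank_prod, hrank, hrank, hrank]
    omega
  obtain ⟨⟨⟨u0, h0⟩, ⟨u1, h1⟩, ⟨u2, h2⟩⟩, hu, hu0⟩ := (Submodule.ne_bot_iff _).mp hker
  have hu' : wedge (u0 + u2) (x 1 + x 2) + wedge (x 0 + x 2) (u1 + u2) = 0 :=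
    congrArg Subtype.val (LinearMap.mem_ker.mp hu)
  obtain ⟨α, β, γ, hα, hγ⟩ := exists_eq_of_wedge_add_wedge_eq_zero hu' (s := s) (t := t) hΔ
  have hα' : ∀ i, u0 i + u2 i = α * (x 0 i + x 2 i) + β * (x 1 i + x 2 i) := congrFun hα
  have hγ' : ∀ i, u1 i + u2 i = γ * (x 0 i + x 2 i) + -α * (x 1 i + x 2 i) := congrFun hγ
  have hxT := fun k => hx.mem_tangentSpace hcone k
  -- a multiple of one of the points lies in the span of the other two tangent spaces only if zero
  have hzero : ∀ i j k, i ≠ j → i ≠ k → j ≠ k → ∀ c : K, ∀ a ∈ tangentSpace (x i),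
      ∀ b ∈ tangentSpace (x j), c • x k = a + b → c = 0 := by
    intro i j k hij hik hjk c a ha b hb hc
    by_contra hne
    refine hmem i j k hij hik hjk ((Submodule.smul_mem_iff _ hne).mp ?_)
    rw [hc]
    exact Submodule.add_mem_sup ha hb
  have hβ : β = 0 := by
    refine hzero 0 2 1 (by decide) (by decide) (by decide) β (u0 - α • x 0)
      (Submodule.sub_mem _ h0 (Submodule.smul_mem _ _ (hxT 0))) (u2 - α • x 2 - β • x 2)
      (Submodule.sub_mem _ (Submodule.sub_mem _ h2 (Submodule.smul_mem _ _ (hxT 2)))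
        (Submodule.smul_mem _ _ (hxT 2))) ?_
    exact funext fun i => by
      simp only [Pi.add_apply, Pi.sub_apply, Pi.smul_apply, smul_eq_mul]
      linear_combination -(hα' i)
  have hγ0 : γ = 0 := by
    refine hzero 1 2 0 (by decide) (by decide) (by decide) γ (u1 + α • x 1)
      (Submodule.add_mem _ h1 (Submodule.smul_mem _ _ (hxT 1))) (u2 + α • x 2 - γ • x 2)
      (Submodule.sub_mem _ (Submodule.add_mem _ h2 (Submodule.smul_mem _ _ (hxT 2)))
        (Submodule.smul_mem _ _ (hxT 2))) ?_
    exact funext fun i => by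
      simp only [Pi.add_apply, Pi.sub_apply, Pi.smul_apply, smul_eq_mul]
      linear_combination -(hγ' i)
  subst hβ hγ0
  have hα0 : α = 0 := by
    have h2α : 2 * α = 0 := by
      refine hzero 0 1 2 (by decide) (by decide) (by decide) (2 * α) (u0 - α • x 0)
        (Submodule.sub_mem _ h0 (Submodule.smul_mem _ _ (hxT 0))) (-u1 - α • x 1)
        (Submodule.sub_mem _ (Submodule.neg_mem _ h1) (Submodule.smul_mem _ _ (hxT 1))) ?_
      exact funext fun i => by
        simp only [Pi.neg_apply, Pi.add_apply, Pi.sub_apply, Pi.smul_apply, smul_eq_mul]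
        linear_combination hγ' i - hα' i
    have := charZero_of_injective_algebraMap (algebraMap ℂ K).injective
    exact (mul_eq_zero.mp h2α).resolve_left two_ne_zero
  subst hα0
  have e0 : u0 = -u2 := by
    rw [eq_neg_iff_add_eq_zero, hα]; simp
  have e1 : u1 = -u2 := by
    rw [eq_neg_iff_add_eq_zero, hγ]; simp
  refine ⟨u2, ?_, fun k => ?_⟩
  · rintro rfl
    refine hu0 ?_
    simp [e0, e1]
  · fin_cases k
    · exact (Submodule.neg_mem_iff _).mp (e0 ▸ h0)
    · exact (Submodule.neg_mem_iff _).mp (e1 ▸ h1)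
    · exact h2

/-- A cone whose ideal is stable under the derivative in the direction `v` is stable under
translation by multiples of `v`. -/
theorem aeval_add_smul_eq_zero {I : Ideal (MvPolynomial σ ℂ)} {v : σ → ℂ}
    (hv : ∀ f ∈ I, ∑ s, pderiv s f * MvPolynomial.C (v s) ∈ I) {a : σ → ℂ}
    (ha : ∀ f ∈ I, aeval a f = 0) {f : MvPolynomial σ ℂ} (hf : f ∈ I) (t : ℂ) :
    aeval (a + t • v) f = 0 := by
  let φ : σ → Polynomial ℂ := fun s => Polynomial.C (a s) + Polynomial.X * Polynomial.C (v s)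
  have hev : ∀ (t : ℂ) (g : MvPolynomial σ ℂ), (aeval φ g).eval t = aeval (a + t • v) g := by
    intro t g
    rw [← Polynomial.coe_aeval_eq_eval, ← AlgHom.comp_apply, comp_aeval]
    congr 2
    funext s
    simp [φ, mul_comm t]
  have hder : ∀ g : MvPolynomial σ ℂ, Polynomial.derivative (aeval φ g) =
      aeval φ (∑ s, pderiv s g * MvPolynomial.C (v s)) := by
    intro g
    have h1 := Polynomial.derivative'.map_mvPolynomial_aeval φ g
    change Polynomial.derivative _ = _ at h1
    rw [h1, map_sum]
    refine Finset.sum_congr rfl fun s _ => ?_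
    rw [map_mul, aeval_C]
    congr 1
    change Polynomial.derivative (φ s) = _
    simp [φ, Polynomial.algebraMap_eq]
  have key : ∀ n : ℕ, ∀ f ∈ I, (aeval φ f).natDegree ≤ n → aeval φ f = 0 := by
    have hconst : ∀ f ∈ I, (aeval φ f).natDegree = 0 → aeval φ f = 0 := by
      intro f hf h
      have h0 := hev 0 f
      rw [zero_smul, add_zero, ha f hf] at h0
      rw [Polynomial.eq_C_of_natDegree_eq_zero h] at h0 ⊢
      rw [Polynomial.eval_C] at h0
      rw [h0, Polynomial.C_0]
    intro n
    induction n with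
    | zero => exact fun f hf h => hconst f hf (Nat.le_zero.mp h)
    | succ n ih =>
      intro f hf h
      have h1 := ih _ (hv f hf) (by
        rw [← hder]
        exact (Polynomial.natDegree_derivative_le _).trans (by omega))
      rw [← hder] at h1
      exact hconst f hf (Polynomial.derivative_eq_zero.mp h1)
  rw [← hev, key _ f hf le_rfl, Polynomial.eval_zero]

end Vertex

/-! ### Generic tuples and linear independence -/

section Independence

variable {K : Type} [Field K] [Algebra ℂ K] {ι σ : Type} [Fintype σ] {C : Set (σ → ℂ)}

/-- Two generic points of a nondegenerate cone are not proportional, already in any two of their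
coordinates: otherwise `a s * b t - a t * b s`, for fixed `a`, is a linear form vanishing on the
cone. -/
theorem IsGeneric.minor_ne_zero {x : ι → σ → K} (hx : IsGeneric C x)
    (hnd : ∀ l : σ → ℂ, (∀ a ∈ C, ∑ s, l s * a s = 0) → l = 0) {i j : ι} (hij : i ≠ j) {s t : σ}
    (hst : s ≠ t) : x i s * x j t - x i t * x j s ≠ 0 := by
  classical
  intro h
  have h0 : aeval (Function.uncurry x)
      (X (i, s) * X (j, t) - X (i, t) * X (j, s) : MvPolynomial (ι × σ) ℂ) = 0 := by
    simpa [Function.uncurry] using h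
  have h1 : ∀ a ∈ C, ∀ b ∈ C, a s * b t - a t * b s = 0 := by
    intro a ha b hb
    have := (hx _).mp h0 (fun k => if k = i then a else b) fun k => by
      by_cases hk : k = i <;> simp [hk, ha, hb]
    simpa [Function.uncurry, hij.symm] using this
  have h2 : ∀ a ∈ C, a s = 0 := by
    intro a ha
    have := congrFun (hnd (Pi.single t (a s) - Pi.single s (a t)) fun b hb => by
      simpa [sub_mul, Finset.sum_sub_distrib, Pi.single_apply] using h1 a ha b hb) t
    simpa [Pi.single_eq_of_ne hst.symm] using this
  have h3 := congrFun (hnd (Pi.single s 1) fun a ha => by simpa [Pi.single_apply] using h2 a ha) s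
  simp at h3

theorem IsGeneric.minor_add_ne_zero {x : Fin 3 → σ → K} (hx : IsGeneric C x)
    (hnd : ∀ l : σ → ℂ, (∀ a ∈ C, ∑ s, l s * a s = 0) → l = 0) (h0 : 0 ∈ C) {s t : σ}
    (hst : s ≠ t) :
    (x 0 s + x 2 s) * (x 1 t + x 2 t) - (x 0 t + x 2 t) * (x 1 s + x 2 s) ≠ 0 := by
  intro h
  have h1 : aeval (Function.uncurry x) ((X (0, s) + X (2, s)) * (X (1, t) + X (2, t)) -
      (X (0, t) + X (2, t)) * (X (1, s) + X (2, s)) : MvPolynomial (Fin 3 × σ) ℂ) = 0 := by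
    simpa [Function.uncurry] using h
  refine hx.minor_ne_zero hnd (i := 0) (j := 1) (by decide) hst ?_
  have h2 : aeval (Function.uncurry x)
      (X (0, s) * X (1, t) - X (0, t) * X (1, s) : MvPolynomial (Fin 3 × σ) ℂ) = 0 := by
    refine (hx _).mpr fun a ha => ?_
    -- specialise the third point to the origin
    have := (hx _).mp h1 ![a 0, a 1, 0] fun k => by
      fin_cases k
      exacts [ha 0, ha 1, h0]
    simpa [Function.uncurry] using this
  simpa [Function.uncurry] using h2

/-- A polynomial in the coordinates of three points that does not vanish at generic triples, and
whose nonvanishing makes the three points linearly independent. -/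
theorem IsGeneric.exists_certificate {x : Fin 3 → σ → K} (hx : IsGeneric C x)
    (hnd : ∀ l : σ → ℂ, (∀ a ∈ C, ∑ s, l s * a s = 0) → l = 0) [Nontrivial σ]
    (hspan : x 2 ∉ Submodule.span K {x 0, x 1}) :
    ∃ g : MvPolynomial (Fin 3 × σ) ℂ, aeval (Function.uncurry x) g ≠ 0 ∧
      ∀ a : Fin 3 → σ → ℂ, aeval (Function.uncurry a) g ≠ 0 → LinearIndependent ℂ a := by
  obtain ⟨s, t, hst⟩ := exists_pair_ne σ
  have hΔ := hx.minor_ne_zero hnd (i := 0) (j := 1) (by decide) hst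
  set Δ := x 0 s * x 1 t - x 0 t * x 1 s with hΔd
  have haev : ∀ {R : Type} [CommRing R] [Algebra ℂ R] (y : Fin 3 → σ → R) (e : Fin 3 → σ),
      aeval (Function.uncurry y) (Matrix.of fun k l : Fin 3 => (X (k, e l) :
        MvPolynomial (Fin 3 × σ) ℂ)).det = (Matrix.of fun k l => y k (e l)).det := by
    intro R _ _ y e
    rw [AlgHom.map_det]
    congr 1
    ext k l
    simp [Function.uncurry]
  obtain ⟨u, hu⟩ : ∃ u, (Matrix.of fun k l => x k ((![s, t, u] : Fin 3 → σ) l)).det ≠ 0 := by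
    by_contra! hcon
    refine hspan (Submodule.mem_span_pair.mpr
      ⟨(x 2 s * x 1 t - x 2 t * x 1 s) / Δ,
        (x 0 s * x 2 t - x 0 t * x 2 s) / Δ, funext fun u => ?_⟩)
    have := hcon u
    rw [Matrix.det_fin_three] at this
    simp only [Matrix.of_apply, Matrix.cons_val] at this
    simp only [Pi.add_apply, Pi.smul_apply, smul_eq_mul]
    field_simp
    rw [hΔd]
    linear_combination -this
  refine ⟨(Matrix.of fun k l : Fin 3 => (X (k, (![s, t, u] : Fin 3 → σ) l) :
    MvPolynomial (Fin 3 × σ) ℂ)).det, ?_, fun a ha => ?_⟩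
  · rw [haev]
    exact hu
  · rw [haev] at ha
    exact LinearIndependent.of_comp (LinearMap.funLeft ℂ ℂ (![s, t, u] : Fin 3 → σ))
      (Matrix.linearIndependent_rows_of_det_ne_zero ha)

end Independence

/-! ### The secant variety -/

section Secant

variable {r : ℕ} {X : Set (ProjSp r)}

theorem IsNondegenerate.eq_zero (h : IsNondegenerate X) (l : Fin (r + 1) → ℂ)
    (hl : ∀ a ∈ affineCone X, ∑ s, l s * a s = 0) : l = 0 := by
  classical
  let φ : (Fin (r + 1) → ℂ) →ₗ[ℂ] ℂ := ∑ s, l s • LinearMap.proj s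
  have hφ : ∀ a, φ a = ∑ s, l s * a s := fun a => by simp [φ]
  have htop := h φ.ker fun x hx => by
    rw [x.submodule_eq, Submodule.span_singleton_le_iff_mem, LinearMap.mem_ker, hφ]
    exact hl _ (rep_mem_affineCone.mpr hx)
  funext s
  have h1 : φ (Pi.single s 1) = 0 := LinearMap.mem_ker.mp (htop ▸ Submodule.mem_top)
  rw [hφ] at h1
  simpa [Pi.single_apply] using h1

/-- Independent points of the cone span a secant plane. -/
theorem exists_mem_secantPlanes {k : ℕ} {a : Fin (k + 1) → Fin (r + 1) → ℂ}
    (ha : LinearIndependent ℂ a) (hX : ∀ i, a i ∈ affineCone X) :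
    ∃ H ∈ secantPlanes k X, H.space = Submodule.span ℂ (Set.range a) :=
  ⟨⟨Submodule.span ℂ (Set.range a), by rw [finrank_span_eq_card ha, Fintype.card_fin]⟩,
    ⟨fun i => Projectivization.mk ℂ (a i) (ha.ne_zero i), fun i => hX i _, by
      simp only [Projectivization.submodule_mk]
      exact Submodule.span_range_eq_iSup⟩, rfl⟩

theorem exists_mem_affineCone_of_mem_secantPlane {k : ℕ} {H : Grass k r}
    (hH : H ∈ secantPlanes k X) :
    ∃ a : Fin (k + 1) → Fin (r + 1) → ℂ, (∀ i, a i ∈ affineCone X) ∧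
      H.space = Submodule.span ℂ (Set.range a) := by
  obtain ⟨x, hx, hs⟩ := hH
  refine ⟨fun i => (x i).rep, fun i => rep_mem_affineCone.mpr (hx i), ?_⟩
  rw [hs, Submodule.span_range_eq_iSup]
  simp only [Projectivization.submodule_eq]

variable {K : Type} [Field K] [Algebra ℂ K] {ι : Type}

/-- The sum of two generic points of the cone is a generic point of the cone over the secant
variety. -/
theorem IsGeneric.mem_coneIdeal_secantVariety_iff {x : ι → Fin (r + 1) → K}
    (hx : IsGeneric (affineCone X) x) (hnd : IsNondegenerate X) (hr : r ≠ 0) {i j : ι}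
    (hij : i ≠ j) (f : MvPolynomial (Fin (r + 1)) ℂ) :
    aeval (x i + x j) f = 0 ↔ f ∈ coneIdeal (secantVariety 1 X) := by
  classical
  rw [secantVariety, coneIdeal_closure]
  have hadd : ∀ a b : Fin (r + 1) → ℂ, (fun k => if k = i then a else b) i +
      (fun k => if k = i then a else b) j = a + b := by
    intro a b
    simp [hij.symm]
  constructor
  · intro h
    have hab : ∀ a ∈ affineCone X, ∀ b ∈ affineCone X, aeval (a + b) f = 0 := by
      intro a ha b hb
      rw [← aeval_uncurry_aeval_add] at h
      have h1 := (hx _).mp h (fun k => if k = i then a else b) fun k => by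
        by_cases hk : k = i <;> simp [hk, ha, hb]
      rwa [aeval_uncurry_aeval_add, hadd] at h1
    intro v hv
    by_cases hv0 : v = 0
    · rw [hv0, ← add_zero (0 : Fin (r + 1) → ℂ)]
      exact hab _ (zero_mem_affineCone X) _ (zero_mem_affineCone X)
    · obtain ⟨H, hH, hvH⟩ := hv hv0
      obtain ⟨a, ha, hs⟩ := exists_mem_affineCone_of_mem_secantPlane hH
      rw [Projectivization.submodule_mk, Submodule.span_singleton_le_iff_mem, hs] at hvH
      obtain ⟨c, rfl⟩ := (Submodule.mem_span_range_iff_exists_fun ℂ).mp hvH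
      rw [Fin.sum_univ_two]
      exact hab _ (smul_mem_affineCone (ha 0) _) _ (smul_mem_affineCone (ha 1) _)
  · intro hf
    obtain ⟨s, t, hst⟩ : ∃ s t : Fin (r + 1), s ≠ t := ⟨0, Fin.last r, by
      intro h
      exact hr (congrArg Fin.val h).symm⟩
    have hΔ := hx.minor_ne_zero hnd.eq_zero hij hst
    refine (mul_eq_zero.mp ?_).resolve_right hΔ
    have h0 : aeval (Function.uncurry x)
        (aeval (fun s => (MvPolynomial.X (i, s) + MvPolynomial.X (j, s) :
          MvPolynomial (ι × Fin (r + 1)) ℂ)) f *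
        (MvPolynomial.X (i, s) * MvPolynomial.X (j, t) -
          MvPolynomial.X (i, t) * MvPolynomial.X (j, s))) = 0 := by
      refine (hx _).mpr fun a ha => ?_
      rw [map_mul, aeval_uncurry_aeval_add, mul_eq_zero, or_iff_not_imp_right]
      intro hne
      have hΔa : a i s * a j t - a i t * a j s ≠ 0 := by simpa [Function.uncurry] using hne
      have hli : LinearIndependent ℂ ![a i, a j] := by
        rw [LinearIndependent.pair_iff]
        intro c d hcd
        have e1 := congrFun hcd s
        have e2 := congrFun hcd t
        simp only [Pi.add_apply, Pi.smul_apply, smul_eq_mul, Pi.zero_apply] at e1 e2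
        refine ⟨(mul_eq_zero.mp ?_).resolve_right hΔa, (mul_eq_zero.mp ?_).resolve_right hΔa⟩
        · linear_combination a j t * e1 - a j s * e2
        · linear_combination a i s * e2 - a i t * e1
      obtain ⟨H, hH, hs⟩ := exists_mem_secantPlanes hli fun k => by
        fin_cases k
        exacts [ha i, ha j]
      refine hf _ fun hne => ⟨H, hH, ?_⟩
      rw [Projectivization.submodule_mk, Submodule.span_singleton_le_iff_mem, hs]
      exact Submodule.add_mem _ (Submodule.subset_span ⟨0, rfl⟩) (Submodule.subset_span ⟨1, rfl⟩)
    rw [map_mul, aeval_uncurry_aeval_add] at h0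
    simpa [Function.uncurry] using h0

end Secant

/-! ### Lines and their Plücker coordinates -/

section Skew

variable {σ R : Type} [LinearOrder σ] [CommRing R]

/-- The extension of a family indexed by increasing pairs to a skew-symmetric matrix. -/
noncomputable def skewExtension (v : (Fin 2 ↪o σ) → R) (s t : σ) : R :=
  if h : s < t then v (exists_orderEmbedding_apply h).choose
  else if h : t < s then -v (exists_orderEmbedding_apply h).choose else 0

theorem skewExtension_apply (v : (Fin 2 ↪o σ) → R) (e : Fin 2 ↪o σ) :
    skewExtension v (e 0) (e 1) = v e := by
  have h : e 0 < e 1 := e.strictMono (by decide)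
  rw [skewExtension, dif_pos h]
  obtain ⟨h0, h1⟩ := (exists_orderEmbedding_apply h).choose_spec
  congr 1
  ext i
  fin_cases i
  exacts [h0, h1]

theorem map_skewExtension {S F : Type} [CommRing S] [FunLike F R S] [RingHomClass F R S] (f : F)
    (v : (Fin 2 ↪o σ) → R) (s t : σ) :
    f (skewExtension v s t) = skewExtension (fun e => f (v e)) s t := by
  rw [skewExtension, skewExtension]
  split_ifs <;> simp

theorem skewExtension_wedge (a b : σ → R) (s t : σ) :
    skewExtension (wedge a b) s t = a s * b t - a t * b s := by
  rcases lt_trichotomy s t with h | rfl | h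
  · obtain ⟨e, rfl, rfl⟩ := exists_orderEmbedding_apply h
    exact skewExtension_apply _ _
  · simp [skewExtension]
  · rw [skewExtension, dif_neg h.not_gt, dif_pos h]
    obtain ⟨h0, h1⟩ := (exists_orderEmbedding_apply h).choose_spec
    rw [wedge, h0, h1]
    ring

/-- The quadratic expression in the skew-symmetric extension of `v` whose vanishing is a Plücker
relation. -/
noncomputable def pluckerRelation (v : (Fin 2 ↪o σ) → R) (s t k l : σ) : R :=
  skewExtension v s t * skewExtension v k l - skewExtension v s k * skewExtension v t l +
    skewExtension v s l * skewExtension v t k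

theorem pluckerRelation_wedge (a b : σ → R) (s t k l : σ) :
    pluckerRelation (wedge a b) s t k l = 0 := by
  simp only [pluckerRelation, skewExtension_wedge]
  ring

/-- A family satisfying the Plücker relations is decomposable. -/
theorem exists_eq_wedge {K : Type} [Field K] {v : (Fin 2 ↪o σ) → K} (hv : v ≠ 0)
    (h : ∀ s t k l, pluckerRelation v s t k l = 0) : ∃ a b : σ → K, v = wedge a b := by
  obtain ⟨e, he⟩ := Function.ne_iff.mp hv
  rw [Pi.zero_apply] at he
  refine ⟨fun s => (v e)⁻¹ * skewExtension v s (e 0), fun s => skewExtension v s (e 1),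
    funext fun c => ?_⟩
  have h1 := h (c 0) (c 1) (e 0) (e 1)
  rw [pluckerRelation, skewExtension_apply, skewExtension_apply] at h1
  simp only [wedge]
  field_simp
  linear_combination h1

theorem linearIndependent_of_wedge_ne_zero {K : Type} [Field K] {a b : σ → K}
    (h : wedge a b ≠ 0) : LinearIndependent K ![a, b] := by
  obtain ⟨e, he⟩ := Function.ne_iff.mp h
  rw [LinearIndependent.pair_iff]
  intro c d hcd
  have e0 := congrFun hcd (e 0)
  have e1 := congrFun hcd (e 1)
  simp only [Pi.add_apply, Pi.smul_apply, smul_eq_mul, Pi.zero_apply] at e0 e1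
  simp only [wedge, Pi.zero_apply] at he
  refine ⟨(mul_eq_zero.mp ?_).resolve_right he, (mul_eq_zero.mp ?_).resolve_right he⟩
  · linear_combination b (e 1) * e0 - b (e 0) * e1
  · linear_combination a (e 0) * e1 - a (e 1) * e0

end Skew

section Lines

variable {r : ℕ}

/-- The Plücker coordinates of a line are proportional to the exterior product of any two vectors
spanning it. -/
theorem Grass.exists_pluckerVec_eq {L : Grass 1 r} {a b : Fin (r + 1) → ℂ}
    (h : L.space = Submodule.span ℂ {a, b}) :
    ∃ c : ℂ, c ≠ 0 ∧ L.pluckerVec = c • wedge a b := by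
  have hrow : ∀ i, ∃ α β : ℂ, α • a + β • b = L.basisMatrix i := fun i => by
    rw [← Submodule.mem_span_pair, ← h]
    exact (Module.finBasisOfFinrankEq ℂ L.space L.finrank_space i).2
  choose α β hαβ using hrow
  have heq : L.pluckerVec = (α 0 * β 1 - α 1 * β 0) • wedge a b := by
    funext e
    have h' : ∀ i s, L.basisMatrix i s = α i * a s + β i * b s := fun i s =>
      (congrFun (hαβ i) s).symm
    rw [Grass.pluckerVec, Matrix.det_fin_two]
    simp only [Matrix.submatrix_apply, id, h', Pi.smul_apply, wedge, smul_eq_mul]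
    ring
  refine ⟨_, fun h0 => L.pluckerVec_ne_zero ?_, heq⟩
  rw [heq, h0, zero_smul]

theorem Grass.wedge_ne_zero {L : Grass 1 r} {a b : Fin (r + 1) → ℂ}
    (h : L.space = Submodule.span ℂ {a, b}) : wedge a b ≠ 0 := by
  intro h0
  obtain ⟨c, -, hc⟩ := Grass.exists_pluckerVec_eq h
  exact L.pluckerVec_ne_zero (by rw [hc, h0, smul_zero])

theorem Grass.plucker_eq_mk {L : Grass 1 r} {a b : Fin (r + 1) → ℂ}
    (h : L.space = Submodule.span ℂ {a, b}) :
    L.plucker = Projectivization.mk ℂ (wedge a b) (Grass.wedge_ne_zero h) := by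
  obtain ⟨c, -, hc⟩ := Grass.exists_pluckerVec_eq h
  rw [Grass.plucker, Projectivization.mk_eq_mk_iff']
  exact ⟨c, hc.symm⟩

theorem Grass.exists_space_eq_span {a b : Fin (r + 1) → ℂ} (h : LinearIndependent ℂ ![a, b]) :
    ∃ L : Grass 1 r, L.space = Submodule.span ℂ {a, b} := by
  refine ⟨⟨Submodule.span ℂ {a, b}, ?_⟩, rfl⟩
  have := finrank_span_eq_card h
  rwa [Matrix.range_cons_cons_empty, Fintype.card_fin] at this

variable {X : Set (ProjSp r)} {K : Type} [Field K] [Algebra ℂ K]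

/-- The lines meeting the plane of three independent points of the cone over `X` in the points
`a 0 + a 2` and `a 1 + a 2`. Rescaling the three points gives all general lines in the plane. -/
def trisecantSublines (X : Set (ProjSp r)) : Set (Grass 1 r) :=
  {L | ∃ a : Fin 3 → Fin (r + 1) → ℂ, (∀ k, a k ∈ affineCone X) ∧ LinearIndependent ℂ a ∧
    L.space = Submodule.span ℂ {a 0 + a 2, a 1 + a 2}}

theorem trisecantSublines_subset :
    trisecantSublines X ⊆ {L | ∃ H ∈ secantGrass 2 X, L.space ≤ H.space} := by
  rintro L ⟨a, ha, hli, hL⟩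
  obtain ⟨H, hH, hs⟩ := exists_mem_secantPlanes hli ha
  refine ⟨H, subset_closure hH, ?_⟩
  rw [hL, hs, Submodule.span_le]
  have hk : ∀ k, a k ∈ Submodule.span ℂ (Set.range a) := fun k => Submodule.subset_span ⟨k, rfl⟩
  rintro _ (rfl | rfl)
  exacts [Submodule.add_mem _ (hk 0) (hk 2), Submodule.add_mem _ (hk 1) (hk 2)]

theorem exists_mem_trisecantSublines {a : Fin 3 → Fin (r + 1) → ℂ} (ha : ∀ k, a k ∈ affineCone X)
    (hli : LinearIndependent ℂ a) :
    ∃ L ∈ trisecantSublines X, L.space = Submodule.span ℂ {a 0 + a 2, a 1 + a 2} := by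
  have h2 : LinearIndependent ℂ ![a 0 + a 2, a 1 + a 2] := by
    rw [LinearIndependent.pair_iff]
    intro s t hst
    have h := Fintype.linearIndependent_iff.mp hli ![s, t, s + t] (by
      rw [Fin.sum_univ_three, ← hst]
      simp only [Matrix.cons_val]
      module)
    exact ⟨h 0, h 1⟩
  obtain ⟨L, hL⟩ := Grass.exists_space_eq_span h2
  exact ⟨L, ⟨a, ha, hli, hL⟩, hL⟩

theorem aeval_uncurry_aeval_wedge {R : Type} [CommRing R] [Algebra ℂ R]
    (x : Fin 3 → Fin (r + 1) → R) (f : MvPolynomial (Fin 2 ↪o Fin (r + 1)) ℂ) :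
    aeval (Function.uncurry x) (aeval (wedge (fun s => (MvPolynomial.X (0, s) +
      MvPolynomial.X (2, s) : MvPolynomial (Fin 3 × Fin (r + 1)) ℂ))
      (fun s => MvPolynomial.X (1, s) + MvPolynomial.X (2, s))) f) =
      aeval (wedge (x 0 + x 2) (x 1 + x 2)) f := by
  rw [← AlgHom.comp_apply, comp_aeval]
  congr 2
  funext e
  simp [Function.uncurry, wedge]

/-- The exterior product of generic points is a generic point of the cone over the Plücker image of
the family of sublines of trisecant planes. -/
theorem IsGeneric.mem_coneIdeal_closure_plucker_iff {x : Fin 3 → Fin (r + 1) → K}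
    (hx : IsGeneric (affineCone X) x) {g : MvPolynomial (Fin 3 × Fin (r + 1)) ℂ}
    (hg : aeval (Function.uncurry x) g ≠ 0)
    (hgli : ∀ a : Fin 3 → Fin (r + 1) → ℂ, aeval (Function.uncurry a) g ≠ 0 →
      LinearIndependent ℂ a) (f : MvPolynomial (Fin 2 ↪o Fin (r + 1)) ℂ) :
    aeval (wedge (x 0 + x 2) (x 1 + x 2)) f = 0 ↔
      f ∈ coneIdeal (closure (Grass.plucker '' trisecantSublines X)) := by
  rw [coneIdeal_closure]
  constructor
  · intro h
    have ha : ∀ a : Fin 3 → Fin (r + 1) → ℂ, (∀ k, a k ∈ affineCone X) →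
        aeval (wedge (a 0 + a 2) (a 1 + a 2)) f = 0 := by
      rw [← aeval_uncurry_aeval_wedge] at h
      intro a ha
      rw [← aeval_uncurry_aeval_wedge]
      exact (hx _).mp h a ha
    intro v hv
    by_cases hv0 : v = 0
    · have h0 := ha 0 fun _ => zero_mem_affineCone X
      have hw : v = wedge ((0 : Fin 3 → Fin (r + 1) → ℂ) 0 + (0 : Fin 3 → Fin (r + 1) → ℂ) 2)
          ((0 : Fin 3 → Fin (r + 1) → ℂ) 1 + (0 : Fin 3 → Fin (r + 1) → ℂ) 2) := by
        rw [hv0]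
        funext e
        simp [wedge]
      rw [hw]
      exact h0
    · obtain ⟨L, ⟨a, haX, -, hL⟩, hLv⟩ := hv hv0
      rw [Grass.plucker_eq_mk hL, Projectivization.mk_eq_mk_iff'] at hLv
      obtain ⟨c, hc⟩ := hLv
      -- scaling all three points by `d` scales the exterior product by `d ^ 2`
      have hc0 : c ≠ 0 := by
        rintro rfl
        rw [zero_smul] at hc
        exact Grass.wedge_ne_zero hL hc.symm
      obtain ⟨d, hd⟩ := IsAlgClosed.exists_pow_nat_eq c⁻¹ (n := 2) (by decide)
      have h1 := ha (fun k => d • a k) fun k => smul_mem_affineCone (haX k) d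
      have hw : v = wedge (d • a 0 + d • a 2) (d • a 1 + d • a 2) := by
        funext e
        have hce := congrFun hc e
        simp only [wedge, Pi.add_apply, Pi.smul_apply, smul_eq_mul] at hce ⊢
        calc v e = c⁻¹ * (c * v e) := by field_simp
          _ = _ := by rw [hce, ← hd]; ring
      rw [hw]
      exact h1
  · intro hf
    refine (mul_eq_zero.mp ?_).resolve_right hg
    rw [← aeval_uncurry_aeval_wedge, ← map_mul]
    refine (hx _).mpr fun a ha => ?_
    rw [map_mul, aeval_uncurry_aeval_wedge, mul_eq_zero, or_iff_not_imp_right]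
    intro hne
    obtain ⟨L, hLM, hL⟩ := exists_mem_trisecantSublines ha (hgli a hne)
    refine hf _ fun h0 => ⟨L, hLM, ?_⟩
    exact Grass.plucker_eq_mk hL

/-- The closure of a set of lines has at least the dimension of the closure of its Plücker image, if
the latter consists of decomposable vectors, that is, satisfies the Plücker relations. -/
theorem topologicalKrullDim_closure_plucker_le {M N : Set (Grass 1 r)} (hMN : closure M ⊆ N)
    (hrel : ∀ v ∈ affineCone (closure (Grass.plucker '' M)), ∀ s t k l,
      pluckerRelation v s t k l = 0) :
    topologicalKrullDim (closure (Grass.plucker '' M)) ≤ topologicalKrullDim N := by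
  have hex : ∀ z : closure (Grass.plucker '' M), ∃ L : N, (L : Grass 1 r).plucker = z := by
    rintro ⟨z, hz⟩
    obtain ⟨a, b, hab⟩ := exists_eq_wedge z.rep_nonzero (hrel _ (rep_mem_affineCone.mpr hz))
    obtain ⟨L, hL⟩ := Grass.exists_space_eq_span
      (linearIndependent_of_wedge_ne_zero (hab ▸ z.rep_nonzero))
    have hLz : L.plucker = z := by
      rw [Grass.plucker_eq_mk hL, ← z.mk_rep]
      simp only [hab]
    refine ⟨⟨L, hMN (closure_induced.mpr ?_)⟩, hLz⟩
    rw [hLz]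
    exact hz
  choose φ hφ using hex
  have hplucker : Topology.IsInducing (Grass.plucker : Grass 1 r → _) := ⟨rfl⟩
  have hind := hplucker.comp (Topology.IsInducing.subtypeVal (t := N))
  refine Topology.IsInducing.topologicalKrullDim_le (f := φ) ((hind.of_comp_iff).mp ?_)
  have : (Grass.plucker ∘ Subtype.val) ∘ φ = Subtype.val := funext hφ
  rw [this]
  exact Topology.IsInducing.subtypeVal

/-- The family of lines in trisecant planes has at least the dimension predicted by the tangent
space at its generic point. -/
theorem IsGeneric.finrank_tangentSpace_wedge_le {x : Fin 3 → Fin (r + 1) → K}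
    (hx : IsGeneric (affineCone X) x) (hnd : IsNondegenerate X) (hr : r ≠ 0)
    (hspan : x 2 ∉ Submodule.span K {x 0, x 1}) {m : ℕ}
    (hG : topologicalKrullDim (secantSubGrass 1 2 X) < ((m : ℕ) : WithBot ℕ∞)) :
    Module.finrank K (tangentSpace (wedge (x 0 + x 2) (x 1 + x 2))) ≤ m := by
  have : NeZero r := ⟨hr⟩
  obtain ⟨g, hg, hgli⟩ := hx.exists_certificate hnd.eq_zero hspan
  have hI := hx.mem_coneIdeal_closure_plucker_iff hg hgli
  set Z := closure (Grass.plucker '' trisecantSublines X) with hZ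
  have hne : Z.Nonempty := by
    obtain ⟨a, ha, hga⟩ : ∃ a : Fin 3 → Fin (r + 1) → ℂ, (∀ k, a k ∈ affineCone X) ∧
        aeval (Function.uncurry a) g ≠ 0 := by
      by_contra! hcon
      exact hg ((hx g).mpr hcon)
    obtain ⟨L, hL, -⟩ := exists_mem_trisecantSublines ha (hgli a hga)
    exact ⟨_, subset_closure ⟨L, hL, rfl⟩⟩
  have hprime : (coneIdeal Z).IsPrime := by
    have : coneIdeal Z = RingHom.ker (aeval (wedge (x 0 + x 2) (x 1 + x 2)) :
        MvPolynomial (Fin 2 ↪o Fin (r + 1)) ℂ →ₐ[ℂ] K) := by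
      ext p; rw [← hI]; rfl
    rw [this]
    exact RingHom.ker_isPrime _
  obtain ⟨d, hd, htr⟩ := exists_topologicalKrullDim_eq_trdeg isClosed_closure hne hprime
  rw [finrank_tangentSpace _ hI htr]
  have hle : topologicalKrullDim Z ≤ topologicalKrullDim (secantSubGrass 1 2 X) := by
    refine topologicalKrullDim_closure_plucker_le (closure_mono trisecantSublines_subset)
      fun v hv s t k l => ?_
    have hmap : ∀ {R : Type} [CommRing R] [Algebra ℂ R] (y : (Fin 2 ↪o Fin (r + 1)) → R),
        aeval y (pluckerRelation (MvPolynomial.X :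
          (Fin 2 ↪o Fin (r + 1)) → MvPolynomial (Fin 2 ↪o Fin (r + 1)) ℂ) s t k l) =
          pluckerRelation y s t k l := by
      intro R _ _ y
      simp only [pluckerRelation, map_add, map_sub, map_mul, map_skewExtension, aeval_X]
    rw [← hmap]
    exact (hI _).mp ((hmap _).trans (pluckerRelation_wedge _ _ _ _ _ _)) v hv
  have hlt := (hd ▸ hle).trans_lt hG
  have : d < m := by exact_mod_cast hlt
  omega

end Lines

/-! ### Cones -/

section Cones

variable {r : ℕ} {X : Set (ProjSp r)}

/-- A closed set is a cone as soon as its ideal is stable under the derivative in a direction. -/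
theorem isProjCone_of_derivative_mem (hclosed : IsClosed X) {v : Fin (r + 1) → ℂ} (hv0 : v ≠ 0)
    (hv : ∀ f ∈ coneIdeal X, ∑ s, pderiv s f * C (v s) ∈ coneIdeal X) : IsProjCone X := by
  have hadd : ∀ a ∈ affineCone X, ∀ t : ℂ, a + t • v ∈ affineCone X := by
    intro a ha t
    have h := affineCone_eq_zeroLocus hclosed
    rw [h]
    exact fun f hf => aeval_add_smul_eq_zero hv (fun g hg => hg a ha) hf t
  have hvX : v ∈ affineCone X := by
    simpa using hadd 0 (zero_mem_affineCone X) 1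
  refine ⟨Projectivization.mk ℂ v hv0, hvX hv0, fun x hx y hy => rep_mem_affineCone.mp ?_⟩
  rw [Projectivization.submodule_mk, x.submodule_eq, y.submodule_eq,
    Submodule.span_singleton_le_iff_mem, ← Submodule.span_insert, Submodule.mem_span_pair] at hy
  obtain ⟨t, c, h⟩ := hy
  rw [← h]
  exact add_comm (c • x.rep) (t • v) ▸ hadd _ (smul_mem_affineCone (rep_mem_affineCone.mpr hx) c) t

end Cones

theorem theorem1p9 (r n : ℕ) (X : Set (ProjSp r))
    (hclosed : IsClosed X) (hirr : IsIrreducible X) (hnondeg : IsNondegenerate X)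
    (hdim : topologicalKrullDim X = ((n : ℕ) : WithBot ℕ∞))
    (hG : topologicalKrullDim (secantSubGrass 1 2 X) < ((3 * n + 2 : ℕ) : WithBot ℕ∞))
    (hS : topologicalKrullDim (secantVariety 1 X) = ((2 * n : ℕ) : WithBot ℕ∞))
    (hr : 2 * n < r) :
    IsProjCone X := by
  have hr0 : r ≠ 0 := by omega
  obtain ⟨K, _, _, x, hx⟩ := exists_isGeneric (ι := Fin 3) (coneIdeal_isPrime hirr)
  have hcone : ∀ v ∈ affineCone X, ∀ c : ℂ, c • v ∈ affineCone X := fun v hv =>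
    smul_mem_affineCone hv
  have hxT := fun k => hx.mem_tangentSpace hcone k
  have hrank : ∀ k, Module.finrank K (tangentSpace (x k)) = n + 1 := by
    intro k
    obtain ⟨d, hd, htr⟩ :=
      exists_topologicalKrullDim_eq_trdeg hclosed hirr.nonempty (coneIdeal_isPrime hirr)
    rw [hdim] at hd
    obtain rfl : n = d := by exact_mod_cast hd
    exact finrank_tangentSpace _ (hx.aeval_eq_zero_iff k) htr
  have hrank2 : ∀ i j, i ≠ j → Module.finrank K (tangentSpace (x i + x j)) = 2 * n + 1 := by
    intro i j hij
    have hI := hx.mem_coneIdeal_secantVariety_iff hnondeg hr0 hij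
    have hne : (secantVariety 1 X).Nonempty := by
      by_contra hempty
      have : IsEmpty (secantVariety 1 X) := Set.isEmpty_coe_sort.mpr
        (Set.not_nonempty_iff_eq_empty.mp hempty)
      have hirr : IsEmpty (TopologicalSpace.IrreducibleCloseds (secantVariety 1 X)) :=
        ⟨fun c => c.isIrreducible.nonempty.elim fun z _ => isEmptyElim z⟩
      rw [topologicalKrullDim, Order.krullDim_eq_bot] at hS
      exact WithBot.bot_ne_coe hS
    have hprime : (coneIdeal (secantVariety 1 X)).IsPrime := by
      have : coneIdeal (secantVariety 1 X) = RingHom.ker (aeval (x i + x j) :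
          MvPolynomial (Fin (r + 1)) ℂ →ₐ[ℂ] K) := by
        ext p; rw [← hI]; rfl
      rw [this]
      exact RingHom.ker_isPrime _
    obtain ⟨d, hd, htr⟩ := exists_topologicalKrullDim_eq_trdeg isClosed_closure hne hprime
    have hd' : ((2 * n : ℕ) : WithBot ℕ∞) = d := hS.symm.trans hd
    obtain rfl : 2 * n = d := by exact_mod_cast hd'
    exact finrank_tangentSpace _ hI htr
  have hinf : ∀ i j, i ≠ j → Module.finrank K
      (tangentSpace (x i) ⊓ tangentSpace (x j) : Submodule K (Fin (r + 1) → K)) = 1 := by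
    intro i j hij
    have h1 := Submodule.finrank_sup_add_finrank_inf_eq (tangentSpace (x i)) (tangentSpace (x j))
    rw [← hx.tangentSpace_add hij, hrank2 i j hij, hrank, hrank] at h1
    omega
  have hmem : ∀ i j k, i ≠ j → i ≠ k → j ≠ k →
      x k ∉ tangentSpace (x i) ⊔ tangentSpace (x j) := by
    intro i j k hij hik hjk
    refine hx.notMem_sup hnondeg.eq_zero hij hik hjk ?_
    -- otherwise the tangent space of the secant variety would be the whole space
    by_contra! hcon
    have htop : tangentSpace (x i + x j) = ⊤ := by
      refine eq_top_iff.mpr fun v _ f hf => ?_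
      have hf0 : f = 0 := by
        by_contra hne
        exact hcon f hne hf
      simp [hf0]
    have h1 := hrank2 i j hij
    rw [htop, finrank_top, Module.finrank_fintype_fun_eq_card, Fintype.card_fin] at h1
    omega
  have hspan : x 2 ∉ Submodule.span K {x 0, x 1} := by
    intro h
    refine hmem 0 1 2 (by decide) (by decide) (by decide) (Submodule.span_le.mpr ?_ h)
    rintro _ (rfl | rfl)
    exacts [Submodule.mem_sup_left (hxT 0), Submodule.mem_sup_right (hxT 1)]
  have h0r : (0 : Fin (r + 1)) ≠ Fin.last r := fun h => hr0 (congrArg Fin.val h).symm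
  have hΔ := hx.minor_add_ne_zero hnondeg.eq_zero (zero_mem_affineCone X) h0r
  obtain ⟨p, hp0, hp⟩ := hx.exists_mem_tangentSpace hcone hrank hmem hΔ
    ((hx.finrank_tangentSpace_wedge_le hnondeg hr0 hspan hG).trans_lt (by omega))
  obtain ⟨j, hj⟩ := Function.ne_iff.mp hp0
  rw [Pi.zero_apply] at hj
  obtain ⟨v, hv⟩ := hx.exists_constant_of_mem_inf (p := (p j)⁻¹ • p) (j := j)
    (fun k => Submodule.smul_mem _ _ (hp k)) (by simp [hj]) hinf
  refine isProjCone_of_derivative_mem hclosed (v := v) ?_ fun f hf => ?_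
  · rintro rfl
    have := hv j
    simp [hj] at this
  · rw [← hx.aeval_eq_zero_iff 0] at hf ⊢
    have h1 := Submodule.smul_mem _ (p j)⁻¹ (hp 0) f hf
    rw [map_sum, ← h1]
    exact Finset.sum_congr rfl fun s _ => by rw [map_mul, aeval_C, hv]
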